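/- Let $\mathbb K$ be an arbitrary field. A $\mathbb K$-linear category is separable over $\mathbb K$ if it is $\mathbb K$-linearly equivalent to the category of finite-dimensional modules over a finite-dimensional separable $\mathbb K$-algebra $A$ (i.e. the multiplication $A\otimes_{\mathbb K}A\to A$ has an $(A,A)$-bimodule section). A fusion category over $\mathbb K$ is a rigid monoidal abelian $\mathbb K$-linear category $\mathcal C$ that is separable over $\mathbb K$, whose tensor product is $\mathbb K$-linear in both arguments, and whose unit object $\mathbf 1$ is simple. Let $\mathcal C$ be a fusion category over $\mathbb K$, let $\mathcal O$ be the set of isomorphism classes of its simple objects, and let $\mathbb E=\mathrm{End}(\mathbf 1)$, which acts on $\mathrm{End}(X)$ through $e\mapsto \ell_X\circ(e\otimes\mathrm{id}_X)\circ\ell_X^{-1}$, where $\ell_X:\mathbf 1\otimes X\to X$ is the left unitor. For an object $V$ let $[V]\in\mathbb N\mathcal O$ be the sum of the classes of the summands in a decomposition of $V$ into simple objects, and equip $\mathbb R\mathcal O$ with the bilinear product with $[X]\cdot[Y]=[X\otimes Y]$ for simple $X,Y$. For $a\in\mathbb R\mathcal O$ with non-negative coefficients let $\mathrm{FPdim}(a)$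 be the largest non-negative eigenvalue of left multiplication by $a$, let $\mathrm{FPdim}(V):=\mathrm{FPdim}([V])$, and define \[\mathrm{FPdim}(\mathcal C):=\mathrm{FPdim}(\mathcal R),\qquad \mathcal R:=\sum_{X\in\mathcal O}\frac{\mathrm{FPdim}(X)}{\dim_{\mathbb E}\mathrm{End}(X)}\,[X].\] Theorem. All of these quantities are well defined: $\mathcal O$ is finite, every object $V$ has a class $[V]$ and it is unique, the largest non-negative eigenvalues exist, and $0<\dim_{\mathbb E}\mathrm{End}(X)<\infty$ for every simple $X$. The canonical coend $R=\int^{V\in\mathcal C}V^*\otimes V$ exists in $\mathcal C$, where $V^*$ is the dual of $V$ with evaluation $V^*\otimes V\to\mathbf 1$, and the canonical maps identify it with \[R\;\cong\;\bigoplus_{X\in\mathcal O}X^*\otimes_{\mathrm{End}(X)}X ,\] where $X^*\otimes_{\mathrm{End}(X)}X$ is the quotient of $X^*\otimes X$ by the relations $f^*\otimes\mathrm{id}_X-\mathrm{id}_{X^*}\otimes f$ for all $f\in\mathrm{End}(X)$. Moreover \[\mathrm{FPdim}(R)\;=\;\mathrm{FPdim}(\mathcal C)\;=\;\sum_{X\in\mathcal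 O}\frac{\mathrm{FPdim}(X)^2}{\dim_{\mathbb E}\mathrm{End}(X)} .\] In particular, $\mathrm{FPdim}(\mathcal C)$ is an algebraic integer. -/

import Mathlib

open CategoryTheory CategoryTheory.Limits CategoryTheory.MonoidalCategory

attribute [local instance] CategoryTheory.Abelian.hasFiniteBiproducts

universe w v u

namespace NACFusion

/-! ### Separable algebras, separable categories, fusion categories -/

/-- A `K`-algebra `A` is separable if multiplication `A ⊗ A → A` has a section `θ` which is a map
of `(A, A)`-bimodules. -/
def IsSeparableAlgebra (K : Type w) (A : Type v) [Field K] [Ring A] [Algebra K A] : Prop :=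
  ∃ θ : A →ₗ[K] TensorProduct K A A,
    (∀ a b : A, θ (a * b) = (LinearMap.mulLeft K a).rTensor A (θ b)) ∧
    (∀ a b : A, θ (a * b) = (LinearMap.mulRight K b).lTensor A (θ a)) ∧
    LinearMap.mul' K A ∘ₗ θ = LinearMap.id

/-- A `K`-linear category is separable if it is `K`-linearly equivalent to the category of
finite-dimensional modules over a finite-dimensional separable `K`-algebra. (Such an algebra can
always be taken to be the opposite of an endomorphism algebra of an object of `C`, so it may be
taken in the universe of the hom-sets.) -/
def IsSeparableCategory (K : Type w) (C : Type u) [Field K] [Category.{v} C] [Preadditive C]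
    [Linear K C] : Prop :=
  ∃ (A : Type v) (_ : Ring A) (_ : Algebra K A),
    Module.Finite K A ∧ IsSeparableAlgebra K A ∧
      ∃ (e : C ≌ FGModuleCat.{v} A) (_ : e.functor.Additive), e.functor.Linear K

/-- A rigid abelian monoidal category, with `K`-bilinear tensor product, is a fusion category over
`K` if it is separable over `K` and its unit object is simple. -/
structure IsFusionCategory (K : Type w) (C : Type u) [Field K] [Category.{v} C] [Abelian C]
    [Linear K C] [MonoidalCategory C] [MonoidalPreadditive C] [MonoidalLinear K C]
    [RigidCategory C] : Prop where
  separable : IsSeparableCategory K C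
  simple_unit : Simple (𝟙_ C)

/-! ### The semiring of isomorphism classes -/

section Grothendieck

variable (C : Type u) [Category.{v} C]

/-- Isomorphism of simple objects. -/
def simpleSetoid [HasZeroMorphisms C] : Setoid {X : C // Simple X} where
  r X Y := Nonempty (X.1 ≅ Y.1)
  iseqv := ⟨fun X => ⟨Iso.refl X.1⟩, fun ⟨i⟩ => ⟨i.symm⟩, fun ⟨i⟩ ⟨j⟩ => ⟨i ≪≫ j⟩⟩

/-- The set `𝒪(C)` of isomorphism classes of simple objects. -/
def SimpleClass [HasZeroMorphisms C] : Type u := Quotient (simpleSetoid C)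

variable {C}

/-- The isomorphism class of a simple object. -/
def SimpleClass.mk [HasZeroMorphisms C] (X : C) (hX : Simple X) : SimpleClass C :=
  Quotient.mk (simpleSetoid C) ⟨X, hX⟩

/-- A simple object representing the given class. -/
noncomputable def SimpleClass.rep [HasZeroMorphisms C] (x : SimpleClass C) : C :=
  (Quotient.out x).1

/-- `m` is the class of `V` in the free commutative monoid on `𝒪(C)`: `V` is a finite direct sum of
simple objects, and `m` is the sum of their classes. -/
def IsClassOf [Abelian C] (V : C) (m : SimpleClass C →₀ ℕ) : Prop :=
  ∃ (n : ℕ) (X : Fin n → C) (hX : ∀ i, Simple (X i)),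
    Nonempty (V ≅ ⨁ X) ∧ m = ∑ i, Finsupp.single (SimpleClass.mk (X i) (hX i)) 1

open Classical in
/-- The class `[V]` of an object in the free commutative monoid on `𝒪(C)`. -/
noncomputable def objClass [Abelian C] (V : C) : SimpleClass C →₀ ℕ :=
  if h : ∃ m, IsClassOf V m then h.choose else 0

/-- The class `[V]` with real coefficients. -/
noncomputable def realClass [Abelian C] (V : C) : SimpleClass C →₀ ℝ :=
  (objClass V).mapRange (fun n : ℕ => (n : ℝ)) Nat.cast_zero

/-- The product on `ℝ`-combinations of simple classes, `[X] · [Y] = [X ⊗ Y]` for simple `X`, `Y`,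
extended bilinearly; `leftMul a` is left multiplication by `a`. -/
noncomputable def leftMul [Abelian C] [MonoidalCategory C] :
    (SimpleClass C →₀ ℝ) →ₗ[ℝ] Module.End ℝ (SimpleClass C →₀ ℝ) :=
  Finsupp.linearCombination ℝ fun x : SimpleClass C =>
    Finsupp.linearCombination ℝ fun y : SimpleClass C => realClass (x.rep ⊗ y.rep)

/-! ### Frobenius-Perron dimensions -/

/-- The non-negative eigenvalues of left multiplication by `a`. -/
def nonnegEigenvalues [Abelian C] [MonoidalCategory C] (a : SimpleClass C →₀ ℝ) : Set ℝ :=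
  {r | 0 ≤ r ∧ (leftMul a).HasEigenvalue r}

/-- The Frobenius-Perron dimension of an element: the largest non-negative eigenvalue of left
multiplication by it. -/
noncomputable def elemFPdim [Abelian C] [MonoidalCategory C] (a : SimpleClass C →₀ ℝ) : ℝ :=
  sSup (nonnegEigenvalues a)

/-- The Frobenius-Perron dimension of an object. -/
noncomputable def objFPdim [Abelian C] [MonoidalCategory C] (X : C) : ℝ :=
  elemFPdim (realClass X)

/-- The left embedding `End(𝟙) → End(X)`, `e ↦ ℓ ∘ (e ⊗ id) ∘ ℓ⁻¹`. -/
def leftEmbedding [Preadditive C] [MonoidalCategory C] [MonoidalPreadditive C] (X : C) :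
    End (𝟙_ C) →+* End X where
  toFun e := (λ_ X).inv ≫ End.asHom e ▷ X ≫ (λ_ X).hom
  map_one' := by simp [End.asHom, End.one_def]
  map_mul' e f := by simp [End.asHom, End.mul_def]
  map_zero' := by simp [End.asHom]
  map_add' e f := by
    have h : (End.asHom (e + f)) ▷ X = End.asHom e ▷ X + End.asHom f ▷ X :=
      MonoidalPreadditive.add_whiskerRight (End.asHom e) (End.asHom f)
    rw [h, Preadditive.add_comp, Preadditive.comp_add]

/-- The dimension of `End(X)` over the endomorphism field `End(𝟙)`, which acts through the left
embedding. -/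
noncomputable def dimEnd [Preadditive C] [MonoidalCategory C] [MonoidalPreadditive C] (X : C) : ℕ :=
  letI : Module (End (𝟙_ C)) (End X) := Module.compHom (End X) (leftEmbedding X)
  Module.finrank (End (𝟙_ C)) (End X)

variable (C)

/-- The regular element `∑ FPdim(X) / dim End(X) · [X]`, a sum over the simple classes. -/
noncomputable def regularElement [Abelian C] [MonoidalCategory C] [MonoidalPreadditive C] :
    SimpleClass C →₀ ℝ :=
  ∑ᶠ x : SimpleClass C, Finsupp.single x (objFPdim x.rep / (dimEnd x.rep : ℝ))

/-- The Frobenius-Perron dimension of the category, `FPdim` of its regular element. -/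
noncomputable def catFPdim [Abelian C] [MonoidalCategory C] [MonoidalPreadditive C] : ℝ :=
  elemFPdim (regularElement C)

end Grothendieck

/-! ### The canonical coend

The dual `X*`, with evaluation `X* ⊗ X ⟶ 𝟙` and coevaluation `𝟙 ⟶ X ⊗ X*`, is the object that
Mathlib writes `Xᘁ`. -/

section Coend

variable (C : Type u) [Category.{v} C] [MonoidalCategory C] [RigidCategory C]

/-- The contravariant functor `V ↦ V*`. -/
noncomputable def dualFunctor : Cᵒᵖ ⥤ C where
  obj V := (V.unop)ᘁ
  map f := (f.unop)ᘁ
  map_id _ := rightAdjointMate_id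
  map_comp _ _ := comp_rightAdjointMate

/-- The functor `(V, W) ↦ V* ⊗ W`. -/
noncomputable def dualTensor : Cᵒᵖ ⥤ C ⥤ C := dualFunctor C ⋙ tensoringLeft C

variable {C}

/-- `π : X* ⊗ X ⟶ Q` exhibits `Q` as `X* ⊗_{End(X)} X`, the quotient of `X* ⊗ X` by the relations
`f* ⊗ id - id ⊗ f` for `f : X ⟶ X`. -/
structure IsEndTensor (X : C) {Q : C} (π : Xᘁ ⊗ X ⟶ Q) : Prop where
  balanced : ∀ f : X ⟶ X, fᘁ ▷ X ≫ π = Xᘁ ◁ f ≫ π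
  universal : ∀ (Z : C) (g : Xᘁ ⊗ X ⟶ Z), (∀ f : X ⟶ X, fᘁ ▷ X ≫ g = Xᘁ ◁ f ≫ g) →
    ∃! h : Q ⟶ Z, π ≫ h = g

end Coend

end NACFusion

/-! A separable category is semisimple with finite-dimensional hom-spaces and finitely many simple
classes: averaging over a separability element splits every monomorphism. Classes of objects are
then read off from dimensions of hom-spaces, and left multiplication on `ℝ`-combinations of simple
classes is an associative action by non-negative matrices. Right multiplication by the sum of all
simple classes is a strictly positive matrix, because `X* ⊗ Z ≠ 0` for simple `X` and `Z`, so by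
Perron-Frobenius theory it has a positive eigenvector, unique up to scaling. Left multiplications
commute with it and hence share this eigenvector; their eigenvalues on it form the character
`IsFusionCategory.character`. A non-negative matrix attains its largest eigenvalue on a positive
eigenvector, so `FPdim` is this character (`isGreatest_character`, `elemFPdim_eq`).

Write `d X = FPdim X` and `h V W = dim_K Hom(V, W)`. Pairing with the regular element, weighted by
`d X / h X X`, computes dimensions: `∑ d x / h x x * h V x = d V`, the sum being over simple classes
(`sum_regularCoeff_mul_homDim`). It follows by adjunction that the regular
element is an eigenvector of left multiplication by `Y` with eigenvalue `d (Y*)`, and therefore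
`d (Y*) = d Y` (`objFPdim_dual`).

The difficulty of the dimension formula is that `X* ⊗_{End(X)} X` is a quotient by a possibly
noncommutative division algebra, so that its class is not visible from that of `X* ⊗ X`. By
adjunction, maps `X* ⊗_{End(X)} X ⟶ W` are `End(X)`-equivariant maps `X ⟶ X ⊗ W`
(`IsEndTensor.homDim_eq`), and the dimension of the quotient is the weighted count of equivariant
maps `weightedHom K X N` at `N = X`. For an arbitrary object `N` with an action of `End(X)` this count
is a fixed multiple of `d N` (`weightedHom_eq`). If `N` is a multiple of the unit object this is linear
algebra over the division ring `End(X)` (`homDim_action_mul_of_isDirectSum_unit`). In general, let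
`δ N` be the difference of the two sides. It is additive in `N` and `δ (N ⊗ Z) = d Z * δ N`, and it
vanishes on the unit-isotypic part of `N ⊗ Y*`, which is an equivariant direct summand. Splitting
this part off for all simple `Y` at once bounds `|δ N| / d N` by a constant factor less than `1` times
the supremum of the same ratio, which is finite; hence `δ = 0`. With
`dim_K End(X) = dim_K End(𝟙) * dim_E End(X)` this gives `d (X* ⊗_{End(X)} X) = d X ^ 2 / dim_E End(X)`
(`objFPdim_endTensor`).

In a semisimple category a dinatural family `V* ⊗ V ⟶ Z` is the same as a family of balanced maps
`X* ⊗ X ⟶ Z` on representatives of the simple classes (`dinatural_ext`, `exists_dinatural`), which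
identifies the coend with `⨁ X* ⊗_{End(X)} X` (`hasCoend_dualTensor`) and gives its dimension.
Dimensions of objects are algebraic integers since multiplication by them preserves the lattice
spanned by the dimensions of the simple objects (`isIntegral_objFPdim`). -/

namespace NACFusion

/-! ### Semisimplicity of separable categories -/

/-- Averaging over a separability element: over a separable algebra every injective linear map of
modules has a linear retraction. -/
theorem IsSeparableAlgebra.exists_retraction {K : Type w} {A : Type v} [Field K] [Ring A]
    [Algebra K A] (hA : IsSeparableAlgebra K A) {M N : Type*} [AddCommGroup M] [AddCommGroup N]
    [Module A M] [Module A N] (f : M →ₗ[A] N) (hf : Function.Injective f) :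
    ∃ g : N →ₗ[A] M, g ∘ₗ f = LinearMap.id := by
  obtain ⟨θ, hl, hr, hm⟩ := hA
  let : Module K M := Module.compHom M (algebraMap K A)
  let : Module K N := Module.compHom N (algebraMap K A)
  have : IsScalarTower K A M := ⟨fun k a m => by
    rw [Algebra.smul_def, mul_smul]; rfl⟩
  have : IsScalarTower K A N := ⟨fun k a m => by
    rw [Algebra.smul_def, mul_smul]; rfl⟩
  obtain ⟨g, hg⟩ := (f.restrictScalars K).exists_leftInverse_of_injective
    (LinearMap.ker_eq_bot.2 hf)
  have hg' : ∀ m, g (f m) = m := fun m => LinearMap.congr_fun hg m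
  -- `Φ (a ⊗ b) = a ∘ g ∘ b`
  let Φ : TensorProduct K A A →ₗ[K] (N →ₗ[K] M) :=
    TensorProduct.lift (LinearMap.mk₂ K
      (fun a b => (Algebra.lsmul K K M a) ∘ₗ g ∘ₗ (Algebra.lsmul K K N b))
      (by intros; ext; simp) (by intros; ext; simp)
      (by intros; ext; simp)
      (by intro c a b; ext n; simpa using smul_comm a c (g (b • n))))
  have hΦ : ∀ a b n, Φ (a ⊗ₜ b) n = a • g (b • n) := fun a b n => rfl
  have h1 : ∀ a t n, Φ ((LinearMap.mulLeft K a).rTensor A t) n = a • Φ t n := by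
    intro a t n
    induction t with
    | zero => simp
    | add x y hx hy => simp only [map_add, LinearMap.add_apply, hx, hy, smul_add]
    | tmul x y => simp only [LinearMap.rTensor_tmul, hΦ, LinearMap.mulLeft_apply, mul_smul]
  have h2 : ∀ a t n, Φ ((LinearMap.mulRight K a).lTensor A t) n = Φ t (a • n) := by
    intro a t n
    induction t with
    | zero => simp
    | add x y hx hy => simp only [map_add, LinearMap.add_apply, hx, hy]
    | tmul x y => simp only [LinearMap.lTensor_tmul, hΦ, LinearMap.mulRight_apply, mul_smul]
  have h3 : ∀ t m, Φ t (f m) = LinearMap.mul' K A t • m := by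
    intro t m
    induction t with
    | zero => simp
    | add x y hx hy => simp only [map_add, LinearMap.add_apply, hx, hy, add_smul]
    | tmul x y => rw [hΦ, ← f.map_smul, hg', LinearMap.mul'_apply, mul_smul]
  refine ⟨{ toFun := Φ (θ 1), map_add' := map_add _, map_smul' := fun a n => ?_ }, ?_⟩
  · rw [RingHom.id_apply, ← h1, ← h2, ← hl, ← hr, one_mul, mul_one]
  · ext m
    have h4 : LinearMap.mul' K A (θ 1) = 1 := LinearMap.congr_fun hm 1
    simp [h3, h4]

/-- The consequences of separability for the underlying abelian category: finite-dimensional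
hom-spaces, semisimplicity, and a generator. -/
structure IsSemisimpleCategory (K : Type w) (C : Type u) [Field K] [Category.{v} C] [Preadditive C]
    [Linear K C] : Prop where
  finite_hom : ∀ X Y : C, Module.Finite K (X ⟶ Y)
  split : ∀ {X Y : C} (f : X ⟶ Y) [Mono f], ∃ g, f ≫ g = 𝟙 X
  exists_generator : ∃ G : C, ∀ V : C, (∀ f : G ⟶ V, f = 0) → 𝟙 V = 0

open ModuleCat in
theorem IsSeparableCategory.isSemisimpleCategory {K : Type w} {C : Type u} [Field K]
    [Category.{v} C] [Preadditive C] [Linear K C] (h : IsSeparableCategory K C) :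
    IsSemisimpleCategory K C := by
  obtain ⟨A, _, _, hfin, hsep, e, _, _⟩ := h
  refine ⟨fun X Y => ?_, fun {X Y} f _ => ?_, ?_⟩
  · let FX := e.functor.obj X
    let FY := e.functor.obj Y
    have : Module.Finite K FX.obj := Module.Finite.trans A FX.obj
    have : Module.Finite K FY.obj := Module.Finite.trans A FY.obj
    let φ : (X ⟶ Y) →ₗ[K] (FX.obj →ₗ[K] FY.obj) :=
      { toFun := fun f => (e.functor.map f).hom.hom.restrictScalars K
        map_add' := fun f g => by
          rw [e.functor.map_add]; rfl
        map_smul' := fun c f => by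
          rw [e.functor.map_smul]; rfl }
    refine Module.Finite.of_injective φ fun f g hfg => e.functor.map_injective ?_
    ext x
    exact LinearMap.congr_fun hfg x
  · have hinj : Function.Injective (e.functor.map f).hom.hom := by
      rw [injective_iff_map_eq_zero]
      intro x hx
      let ψ : FGModuleCat.of A A ⟶ e.functor.obj X :=
        ObjectProperty.homMk (ModuleCat.ofHom (LinearMap.toSpanSingleton A _ x))
      have h0 : ψ ≫ e.functor.map f = 0 ≫ e.functor.map f := by
        ext
        simpa [ψ] using hx
      have h1 := (cancel_mono (e.functor.map f)).1 h0
      have h2 := congrArg (fun t => t.hom.hom (1 : A)) h1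
      simpa [ψ] using h2
    obtain ⟨g, hg⟩ := hsep.exists_retraction _ hinj
    refine ⟨e.functor.preimage (ObjectProperty.homMk (ModuleCat.ofHom g)), ?_⟩
    apply e.functor.map_injective
    rw [e.functor.map_comp, e.functor.map_preimage, e.functor.map_id]
    ext x
    exact LinearMap.congr_fun hg x
  · refine ⟨e.inverse.obj (FGModuleCat.of A A), fun V hV => ?_⟩
    apply e.functor.map_injective
    rw [e.functor.map_id, e.functor.map_zero]
    ext x
    let ψ : FGModuleCat.of A A ⟶ e.functor.obj V :=
      ObjectProperty.homMk (ModuleCat.ofHom (LinearMap.toSpanSingleton A _ x))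
    have h1 := hV ((e.symm.toAdjunction.homEquiv _ _).symm ψ)
    have h2 : ψ = 0 := by
      rw [← (e.symm.toAdjunction.homEquiv _ _).apply_symm_apply ψ, h1]
      simp [Adjunction.homEquiv_apply]
    have h3 := congrArg (fun t => t.hom.hom (1 : A)) h2
    simpa [ψ] using h3

/-! ### Finite direct sums and dimensions of hom-spaces -/

section DirectSum

variable {C : Type u} [Category.{v} C] [Preadditive C]

/-- The morphisms `j a : X a ⟶ V` and `p a : V ⟶ X a` exhibit `V` as the direct sum of the finite
family `X`. -/
structure IsDirectSum {ι : Type*} [Fintype ι] (X : ι → C) {V : C} (j : ∀ a, X a ⟶ V)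
    (p : ∀ a, V ⟶ X a) : Prop where
  self : ∀ a, j a ≫ p a = 𝟙 (X a)
  ne : ∀ a b, a ≠ b → j a ≫ p b = 0
  total : ∑ a, p a ≫ j a = 𝟙 V

/-- Two retracts `Y` and `Z` of `V` exhibit `V` as the direct sum of `Y` and `Z`. -/
structure IsBinarySum {Y Z V : C} (i₁ : Y ⟶ V) (p₁ : V ⟶ Y) (i₂ : Z ⟶ V) (p₂ : V ⟶ Z) : Prop where
  self₁ : i₁ ≫ p₁ = 𝟙 Y
  self₂ : i₂ ≫ p₂ = 𝟙 Z
  ne₁ : i₁ ≫ p₂ = 0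
  ne₂ : i₂ ≫ p₁ = 0
  total : p₁ ≫ i₁ + p₂ ≫ i₂ = 𝟙 V

theorem sum_biproduct_π_ι [HasFiniteBiproducts C] {ι : Type*} [Fintype ι] (X : ι → C) :
    ∑ a, biproduct.π X a ≫ biproduct.ι X a = 𝟙 (⨁ X) := by
  classical
  ext b
  rw [Preadditive.sum_comp, Finset.sum_eq_single b]
  · simp
  · intro a _ hab
    rw [Category.assoc, biproduct.ι_π_ne _ hab, comp_zero]
  · simp

theorem IsDirectSum.nonempty_iso [HasFiniteBiproducts C] {ι : Type*} [Fintype ι] {X : ι → C}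
    {V : C} {j : ∀ a, X a ⟶ V} {p : ∀ a, V ⟶ X a} (h : IsDirectSum X j p) :
    Nonempty (V ≅ ⨁ X) := by
  classical
  refine ⟨⟨biproduct.lift p, biproduct.desc j, ?_, ?_⟩⟩
  · have : ∀ a, biproduct.lift p ≫ biproduct.π X a ≫ biproduct.ι X a ≫ biproduct.desc j
        = p a ≫ j a := fun a => by simp
    rw [← h.total, ← Finset.sum_congr rfl fun a _ => this a, ← Preadditive.comp_sum]
    simp only [← Category.assoc]
    rw [← Preadditive.sum_comp, sum_biproduct_π_ι]
    simp
  · ext a b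
    rcases eq_or_ne a b with rfl | hab
    · simp [h.self]
    · simp [h.ne _ _ hab.symm, biproduct.ι_π_ne _ hab.symm]

theorem IsDirectSum.of_iso [HasFiniteBiproducts C] {ι : Type*} [Fintype ι] {X : ι → C}
    {V : C} (i : V ≅ ⨁ X) :
    IsDirectSum X (fun a => biproduct.ι X a ≫ i.inv) (fun a => i.hom ≫ biproduct.π X a) := by
  classical
  refine ⟨fun a => by simp, fun a b hab => by simp [biproduct.ι_π_ne _ hab], ?_⟩
  have : ∑ a, (i.hom ≫ biproduct.π X a) ≫ biproduct.ι X a ≫ i.inv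
      = i.hom ≫ (∑ a, biproduct.π X a ≫ biproduct.ι X a) ≫ i.inv := by
    simp only [Preadditive.comp_sum, Preadditive.sum_comp, Category.assoc]
  rw [this, sum_biproduct_π_ι]
  simp

theorem IsDirectSum.reindex {ι κ : Type*} [Fintype ι] [Fintype κ] {X : ι → C}
    {V : C} {j : ∀ a, X a ⟶ V} {p : ∀ a, V ⟶ X a} (h : IsDirectSum X j p) (e : κ ≃ ι) :
    IsDirectSum (fun k => X (e k)) (fun k => j (e k)) (fun k => p (e k)) where
  self k := h.self _
  ne k l hkl := h.ne _ _ (e.injective.ne hkl)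
  total := by rw [← h.total]; exact e.sum_comp (fun a => p a ≫ j a)

theorem IsDirectSum.sum {ι κ : Type*} [Fintype ι] [Fintype κ] {X : ι → C} {X' : κ → C} {Y Z V : C}
    {j : ∀ a, X a ⟶ Y} {p : ∀ a, Y ⟶ X a} (h : IsDirectSum X j p)
    {j' : ∀ a, X' a ⟶ Z} {p' : ∀ a, Z ⟶ X' a} (h' : IsDirectSum X' j' p')
    {i₁ : Y ⟶ V} {p₁ : V ⟶ Y} {i₂ : Z ⟶ V} {p₂ : V ⟶ Z} (hV : IsBinarySum i₁ p₁ i₂ p₂) :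
    IsDirectSum (Sum.elim X X')
      (fun a => Sum.rec (motive := fun a => Sum.elim X X' a ⟶ V)
        (fun a => j a ≫ i₁) (fun a => j' a ≫ i₂) a)
      (fun a => Sum.rec (motive := fun a => V ⟶ Sum.elim X X' a)
        (fun a => p₁ ≫ p a) (fun a => p₂ ≫ p' a) a) where
  self := by
    rintro (a | a)
    · simp [reassoc_of% hV.self₁, h.self]
    · simp [reassoc_of% hV.self₂, h'.self]
  ne := by
    rintro (a | a) (b | b) hab
    · simp [reassoc_of% hV.self₁, h.ne a b (fun e => hab (by rw [e]))]; rfl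
    · simp [reassoc_of% hV.ne₁]; rfl
    · simp [reassoc_of% hV.ne₂]; rfl
    · simp [reassoc_of% hV.self₂, h'.ne a b (fun e => hab (by rw [e]))]; rfl
  total := by
    have h1 : ∑ a, (p₁ ≫ p a) ≫ j a ≫ i₁ = p₁ ≫ i₁ := by
      have : ∑ a, (p₁ ≫ p a) ≫ j a ≫ i₁ = p₁ ≫ (∑ a, p a ≫ j a) ≫ i₁ := by
        simp only [Preadditive.comp_sum, Preadditive.sum_comp, Category.assoc]
      rw [this, h.total, Category.id_comp]
    have h2 : ∑ a, (p₂ ≫ p' a) ≫ j' a ≫ i₂ = p₂ ≫ i₂ := by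
      have : ∑ a, (p₂ ≫ p' a) ≫ j' a ≫ i₂ = p₂ ≫ (∑ a, p' a ≫ j' a) ≫ i₂ := by
        simp only [Preadditive.comp_sum, Preadditive.sum_comp, Category.assoc]
      rw [this, h'.total, Category.id_comp]
    rw [← hV.total, Fintype.sum_sum_type, ← h1, ← h2]; rfl

/-- An additive functor preserves direct sums. -/
theorem IsDirectSum.map {D : Type*} [Category* D] [Preadditive D] (F : C ⥤ D) [F.Additive]
    {ι : Type*} [Fintype ι] {X : ι → C}
    {V : C} {j : ∀ a, X a ⟶ V} {p : ∀ a, V ⟶ X a} (h : IsDirectSum X j p) :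
    IsDirectSum (fun a => F.obj (X a)) (fun a => F.map (j a)) (fun a => F.map (p a)) where
  self a := by rw [← F.map_comp, h.self, F.map_id]
  ne a b hab := by rw [← F.map_comp, h.ne a b hab, F.map_zero]
  total := by simp only [← F.map_comp, ← F.map_sum, h.total, F.map_id]

/-- A retract has a complement. -/
theorem exists_isBinarySum [HasKernels C] {Y V : C} {i : Y ⟶ V} {p : V ⟶ Y} (h : i ≫ p = 𝟙 Y) :
    ∃ (Z : C) (i' : Z ⟶ V) (p' : V ⟶ Z), IsBinarySum i p i' p' := by
  have h1 : (𝟙 V - p ≫ i) ≫ p = 0 := by simp [h]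
  refine ⟨kernel p, kernel.ι p, kernel.lift p (𝟙 V - p ≫ i) h1, h, ?_, ?_, ?_, ?_⟩
  · rw [← cancel_mono (kernel.ι p)]; simp
  · rw [← cancel_mono (kernel.ι p)]; simp [reassoc_of% h]
  · simp
  · simp

variable (K : Type w) [Field K] [Linear K C]

/-- The dimension of a hom-space over the base field. -/
noncomputable def homDim (V W : C) : ℕ := Module.finrank K (V ⟶ W)

variable {K}

theorem homDim_congr {V V' W W' : C} (i : V ≅ V') (j : W ≅ W') : homDim K V W = homDim K V' W' :=
  LinearEquiv.finrank_eq
    (LinearEquiv.ofLinearMap (Linear.leftComp K W' i.inv ∘ₗ Linear.rightComp K V j.hom)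
      (Linear.leftComp K W i.hom ∘ₗ Linear.rightComp K V' j.inv)
      (by ext; simp) (by ext; simp))

theorem homDim_pos_of_ne {V W : C} [Module.Finite K (V ⟶ W)] {f : V ⟶ W} (hf : f ≠ 0) :
    0 < homDim K V W := by
  have : Nontrivial (V ⟶ W) := ⟨f, 0, hf⟩
  exact Module.finrank_pos

theorem eq_zero_of_homDim {V W : C} [Module.Finite K (V ⟶ W)] (h : homDim K V W = 0) (f : V ⟶ W) :
    f = 0 := by
  by_contra hf
  exact (homDim_pos_of_ne (K := K) hf).ne' h

theorem homDim_eq_zero {V W : C} (h : ∀ f : V ⟶ W, f = 0) : homDim K V W = 0 := by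
  have : Subsingleton (V ⟶ W) := ⟨fun f g => by rw [h f, h g]⟩
  exact Module.finrank_zero_of_subsingleton

theorem IsDirectSum.homDim_left {ι : Type*} [Fintype ι] {X : ι → C}
    {V : C} {j : ∀ a, X a ⟶ V} {p : ∀ a, V ⟶ X a} (h : IsDirectSum X j p) (W : C)
    [∀ a, Module.Finite K (X a ⟶ W)] :
    homDim K V W = ∑ a, homDim K (X a) W := by
  classical
  let e : (V ⟶ W) ≃ₗ[K] (∀ a, X a ⟶ W) := LinearEquiv.ofLinearMap
    (LinearMap.pi fun a => Linear.leftComp K W (j a))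
    (∑ a, Linear.leftComp K W (p a) ∘ₗ LinearMap.proj a)
    (LinearMap.ext fun f => funext fun a => by
      simp only [LinearMap.comp_apply, LinearMap.pi_apply, LinearMap.sum_apply, LinearMap.proj_apply,
        Linear.leftComp_apply, Preadditive.comp_sum, LinearMap.id_apply, ← Category.assoc]
      rw [Finset.sum_eq_single a, h.self, Category.id_comp]
      · intro b _ hb; rw [h.ne _ _ hb.symm, zero_comp]
      · simp)
    (by
      ext f
      simp only [LinearMap.comp_apply, LinearMap.pi_apply, LinearMap.sum_apply, LinearMap.proj_apply,
        Linear.leftComp_apply, LinearMap.id_apply, ← Category.assoc]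
      rw [← Preadditive.sum_comp, h.total, Category.id_comp])
  exact e.finrank_eq.trans (Module.finrank_pi_fintype K)

theorem IsDirectSum.homDim_right {ι : Type*} [Fintype ι] {X : ι → C}
    {V : C} {j : ∀ a, X a ⟶ V} {p : ∀ a, V ⟶ X a} (h : IsDirectSum X j p) (W : C)
    [∀ a, Module.Finite K (W ⟶ X a)] :
    homDim K W V = ∑ a, homDim K W (X a) := by
  classical
  let e : (W ⟶ V) ≃ₗ[K] (∀ a, W ⟶ X a) := LinearEquiv.ofLinearMap
    (LinearMap.pi fun a => Linear.rightComp K W (p a))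
    (∑ a, Linear.rightComp K W (j a) ∘ₗ LinearMap.proj a)
    (LinearMap.ext fun f => funext fun a => by
      simp only [LinearMap.comp_apply, LinearMap.pi_apply, LinearMap.sum_apply, LinearMap.proj_apply,
        Linear.rightComp_apply, Preadditive.sum_comp, LinearMap.id_apply, Category.assoc]
      rw [Finset.sum_eq_single a, h.self, Category.comp_id]
      · intro b _ hb; rw [h.ne _ _ hb, comp_zero]
      · simp)
    (by
      ext f
      simp only [LinearMap.comp_apply, LinearMap.pi_apply, LinearMap.sum_apply, LinearMap.proj_apply,
        Linear.rightComp_apply, LinearMap.id_apply, Category.assoc]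
      rw [← Preadditive.comp_sum, h.total, Category.comp_id])
  exact e.finrank_eq.trans (Module.finrank_pi_fintype K)

theorem IsBinarySum.homDim_left {Y Z V : C} {i₁ : Y ⟶ V} {p₁ : V ⟶ Y} {i₂ : Z ⟶ V} {p₂ : V ⟶ Z}
    (h : IsBinarySum i₁ p₁ i₂ p₂) (W : C) [Module.Finite K (Y ⟶ W)] [Module.Finite K (Z ⟶ W)] :
    homDim K V W = homDim K Y W + homDim K Z W := by
  let e : (V ⟶ W) ≃ₗ[K] ((Y ⟶ W) × (Z ⟶ W)) := LinearEquiv.ofLinearMap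
    ((Linear.leftComp K W i₁).prod (Linear.leftComp K W i₂))
    ((Linear.leftComp K W p₁).coprod (Linear.leftComp K W p₂))
    (by
      ext f
      · simp [reassoc_of% h.self₁]
      · simp [reassoc_of% h.ne₂]
      · simp [reassoc_of% h.ne₁]
      · simp [reassoc_of% h.self₂])
    (by
      ext f
      change p₁ ≫ i₁ ≫ f + p₂ ≫ i₂ ≫ f = f
      rw [← Category.assoc, ← Category.assoc, ← Preadditive.add_comp, h.total, Category.id_comp])
  exact e.finrank_eq.trans Module.finrank_prod

theorem IsBinarySum.homDim_right {Y Z V : C} {i₁ : Y ⟶ V} {p₁ : V ⟶ Y} {i₂ : Z ⟶ V} {p₂ : V ⟶ Z}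
    (h : IsBinarySum i₁ p₁ i₂ p₂) (W : C) [Module.Finite K (W ⟶ Y)] [Module.Finite K (W ⟶ Z)] :
    homDim K W V = homDim K W Y + homDim K W Z := by
  let e : (W ⟶ V) ≃ₗ[K] ((W ⟶ Y) × (W ⟶ Z)) := LinearEquiv.ofLinearMap
    ((Linear.rightComp K W p₁).prod (Linear.rightComp K W p₂))
    ((Linear.rightComp K W i₁).coprod (Linear.rightComp K W i₂))
    (by
      ext f
      · simp [h.self₁]
      · simp [h.ne₁]
      · simp [h.ne₂]
      · simp [h.self₂])
    (by
      ext f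
      change (f ≫ p₁) ≫ i₁ + (f ≫ p₂) ≫ i₂ = f
      rw [Category.assoc, Category.assoc, ← Preadditive.comp_add, h.total, Category.comp_id])
  exact e.finrank_eq.trans Module.finrank_prod

end DirectSum

/-! ### Decomposition into simple objects -/

section Semisimple

variable {K : Type w} {C : Type u} [Field K] [Category.{v} C] [Abelian C] [Linear K C]

theorem IsSemisimpleCategory.exists_isDirectSum (hS : IsSemisimpleCategory K C) (V : C) :
    ∃ (n : ℕ) (X : Fin n → C) (j : ∀ a, X a ⟶ V) (p : ∀ a, V ⟶ X a),
      (∀ a, Simple (X a)) ∧ IsDirectSum X j p := by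
  have := hS.finite_hom
  induction hd : homDim K V V using Nat.strong_induction_on generalizing V with
  | _ d ih =>
  by_cases h0 : 𝟙 V = 0
  · exact ⟨0, fun a => a.elim0, fun a => a.elim0, fun a => a.elim0, fun a => a.elim0,
      ⟨fun a => a.elim0, fun a => a.elim0, by simp [h0]⟩⟩
  by_cases hs : Simple V
  · exact ⟨1, fun _ => V, fun _ => 𝟙 V, fun _ => 𝟙 V, fun _ => hs,
      ⟨by simp, fun a b hab => (hab (Subsingleton.elim _ _)).elim, by simp⟩⟩
  obtain ⟨Y, i, hi, hne, hiso⟩ : ∃ (Y : C) (i : Y ⟶ V), Mono i ∧ i ≠ 0 ∧ ¬ IsIso i := by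
    by_contra! hcon
    refine hs ⟨fun {Y} f _ => ⟨fun hf h => h0 ?_, fun hf => hcon Y f inferInstance hf⟩⟩
    subst h; rw [← IsIso.inv_hom_id (0 : Y ⟶ V), comp_zero]
  obtain ⟨p, hp⟩ := hS.split i
  obtain ⟨Z, i', p', hV⟩ := exists_isBinarySum hp
  have hY : 0 < homDim K Y Y := homDim_pos_of_ne (f := 𝟙 Y) fun h => hne <| by
    rw [← Category.id_comp i, h, zero_comp]
  have hZ : 0 < homDim K Z Z := homDim_pos_of_ne (f := 𝟙 Z) fun h => hiso <| by
    refine ⟨p, hp, ?_⟩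
    rw [← hV.total, ← Category.id_comp i', h, zero_comp, comp_zero, add_zero]
  rw [hV.homDim_left, hV.homDim_right, hV.homDim_right] at hd
  obtain ⟨n, X, j, q, hX, h⟩ := ih _ (by omega) Y rfl
  obtain ⟨m, X', j', q', hX', h'⟩ := ih _ (by omega) Z rfl
  refine ⟨n + m, _, _, _, fun a => ?_, (h.sum h' hV).reindex finSumFinEquiv.symm⟩
  rcases finSumFinEquiv.symm a with b | b
  · exact hX b
  · exact hX' b

end Semisimple

/-! ### Classes of objects -/

section Classes

variable {K : Type w} {C : Type u} [Field K] [Category.{v} C] [Abelian C] [Linear K C]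

instance SimpleClass.simple_rep (x : SimpleClass C) : Simple x.rep := (Quotient.out x).2

theorem SimpleClass.mk_rep (x : SimpleClass C) (h : Simple x.rep) : SimpleClass.mk x.rep h = x :=
  Quotient.out_eq x

theorem SimpleClass.mk_eq_mk_iff {X Y : C} {hX : Simple X} {hY : Simple Y} :
    SimpleClass.mk X hX = SimpleClass.mk Y hY ↔ Nonempty (X ≅ Y) :=
  Quotient.eq (r := simpleSetoid C)

theorem SimpleClass.nonempty_rep_iso {X : C} (hX : Simple X) :
    Nonempty ((SimpleClass.mk X hX).rep ≅ X) :=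
  SimpleClass.mk_eq_mk_iff.1 (SimpleClass.mk_rep (SimpleClass.mk X hX) inferInstance)

theorem SimpleClass.hom_eq_zero {x y : SimpleClass C} (h : x ≠ y) (f : x.rep ⟶ y.rep) : f = 0 := by
  by_contra hf
  have := isIso_of_hom_simple hf
  refine h ?_
  rw [← x.mk_rep inferInstance, ← y.mk_rep inferInstance]
  exact SimpleClass.mk_eq_mk_iff.2 ⟨asIso f⟩

theorem IsClassOf.exists_isDirectSum {V : C} {m : SimpleClass C →₀ ℕ} (h : IsClassOf V m) :
    ∃ (n : ℕ) (x : Fin n → SimpleClass C) (j : ∀ a, (x a).rep ⟶ V) (p : ∀ a, V ⟶ (x a).rep),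
      IsDirectSum (fun a => (x a).rep) j p ∧ m = ∑ a, Finsupp.single (x a) 1 := by
  obtain ⟨n, X, hX, ⟨i⟩, rfl⟩ := h
  have e := fun a => Classical.choice (SimpleClass.nonempty_rep_iso (hX a))
  have hV := IsDirectSum.of_iso i
  refine ⟨n, fun a => SimpleClass.mk (X a) (hX a), fun a => (e a).hom ≫ biproduct.ι X a ≫ i.inv,
    fun a => (i.hom ≫ biproduct.π X a) ≫ (e a).inv, ⟨fun a => ?_, fun a b hab => ?_, ?_⟩, rfl⟩
  · have := hV.self a
    simp only [Category.assoc] at this ⊢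
    rw [reassoc_of% this, Iso.hom_inv_id]
  · have := hV.ne a b hab
    simp only [Category.assoc] at this ⊢
    rw [reassoc_of% this, zero_comp, comp_zero]
  · rw [← hV.total]
    simp

theorem SimpleClass.homDim_rep [DecidableEq (SimpleClass C)] (x y : SimpleClass C) :
    homDim K x.rep y.rep = if x = y then homDim K y.rep y.rep else 0 := by
  split_ifs with h
  · rw [h]
  · exact homDim_eq_zero (SimpleClass.hom_eq_zero h)

omit [Field K] [Linear K C] in
theorem realClass_nonneg (V : C) (x : SimpleClass C) : 0 ≤ realClass V x := Nat.cast_nonneg _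

variable (hS : IsSemisimpleCategory K C)
include hS

namespace IsSemisimpleCategory

theorem homDim_self_pos (x : SimpleClass C) : 0 < homDim K x.rep x.rep :=
  have := hS.finite_hom
  homDim_pos_of_ne (f := 𝟙 x.rep) (id_nonzero _)

theorem exists_isClassOf (V : C) : ∃ m, IsClassOf V m := by
  obtain ⟨n, X, j, p, hX, h⟩ := hS.exists_isDirectSum V
  exact ⟨_, n, X, hX, h.nonempty_iso, rfl⟩

theorem isClassOf_mul_homDim {V : C} {m : SimpleClass C →₀ ℕ} (h : IsClassOf V m)
    (y : SimpleClass C) : m y * homDim K y.rep y.rep = homDim K V y.rep := by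
  classical
  have := hS.finite_hom
  obtain ⟨n, x, j, p, hV, rfl⟩ := h.exists_isDirectSum
  rw [hV.homDim_left, Finsupp.finsetSum_apply, Finset.sum_mul]
  refine Finset.sum_congr rfl fun a _ => ?_
  rw [SimpleClass.homDim_rep (x a), Finsupp.single_apply]
  split_ifs <;> simp

theorem isClassOf_unique {V : C} {m m' : SimpleClass C →₀ ℕ} (h : IsClassOf V m)
    (h' : IsClassOf V m') : m = m' := by
  ext y
  refine Nat.eq_of_mul_eq_mul_right (hS.homDim_self_pos y) ?_
  rw [hS.isClassOf_mul_homDim h, hS.isClassOf_mul_homDim h']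

theorem isClassOf_objClass (V : C) : IsClassOf V (objClass V) := by
  rw [objClass, dif_pos (hS.exists_isClassOf V)]
  exact (hS.exists_isClassOf V).choose_spec

theorem exists_isDirectSum_rep (V : C) :
    ∃ (n : ℕ) (x : Fin n → SimpleClass C) (j : ∀ a, (x a).rep ⟶ V) (p : ∀ a, V ⟶ (x a).rep),
      IsDirectSum (fun a => (x a).rep) j p := by
  obtain ⟨n, x, j, p, hV, -⟩ := (hS.isClassOf_objClass V).exists_isDirectSum
  exact ⟨n, x, j, p, hV⟩

theorem objClass_mul_homDim (V : C) (y : SimpleClass C) :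
    objClass V y * homDim K y.rep y.rep = homDim K V y.rep :=
  hS.isClassOf_mul_homDim (hS.isClassOf_objClass V) y

/-- In a semisimple category the dimension of hom-spaces is a symmetric function of two objects. -/
theorem homDim_comm (V W : C) : homDim K V W = homDim K W V := by
  classical
  have := hS.finite_hom
  obtain ⟨n, x, j, p, hV⟩ := hS.exists_isDirectSum_rep V
  obtain ⟨m, y, j', p', hW⟩ := hS.exists_isDirectSum_rep W
  rw [hV.homDim_left, hV.homDim_right]
  simp only [hW.homDim_left, hW.homDim_right]
  refine Finset.sum_congr rfl fun a _ => Finset.sum_congr rfl fun b _ => ?_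
  rcases eq_or_ne (x a) (y b) with h | h
  · rw [h]
  · rw [SimpleClass.homDim_rep (x a), if_neg h, SimpleClass.homDim_rep (y b), if_neg h.symm]

theorem realClass_mul_homDim (V : C) (y : SimpleClass C) :
    realClass V y * (homDim K y.rep y.rep : ℝ) = homDim K V y.rep := by
  rw [← hS.objClass_mul_homDim V, Nat.cast_mul]
  rfl

theorem realClass_apply (V : C) (y : SimpleClass C) :
    realClass V y = (homDim K V y.rep : ℝ) / homDim K y.rep y.rep := by
  have := hS.homDim_self_pos y
  rw [eq_div_iff (by positivity), hS.realClass_mul_homDim]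

theorem realClass_congr {V W : C} (i : V ≅ W) : realClass V = realClass W := by
  ext y
  rw [hS.realClass_apply, hS.realClass_apply, homDim_congr i (Iso.refl _)]

theorem realClass_rep (x : SimpleClass C) : realClass x.rep = Finsupp.single x 1 := by
  classical
  ext y
  have := hS.homDim_self_pos y
  rw [hS.realClass_apply, SimpleClass.homDim_rep, Finsupp.single_apply]
  split_ifs
  · rw [div_self (by positivity)]
  · simp

theorem realClass_isDirectSum {ι : Type*} [Fintype ι] {X : ι → C}
    {V : C} {j : ∀ a, X a ⟶ V} {p : ∀ a, V ⟶ X a} (h : IsDirectSum X j p) :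
    realClass V = ∑ a, realClass (X a) := by
  have := hS.finite_hom
  ext y
  simp only [Finsupp.finsetSum_apply, hS.realClass_apply, h.homDim_left, Nat.cast_sum,
    Finset.sum_div]

theorem realClass_isBinarySum {Y Z V : C} {i₁ : Y ⟶ V} {p₁ : V ⟶ Y} {i₂ : Z ⟶ V} {p₂ : V ⟶ Z}
    (h : IsBinarySum i₁ p₁ i₂ p₂) : realClass V = realClass Y + realClass Z := by
  have := hS.finite_hom
  ext y
  simp only [Finsupp.add_apply, hS.realClass_apply, h.homDim_left, Nat.cast_add, add_div]

theorem finite_simpleClass : Finite (SimpleClass C) := by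
  have := hS.finite_hom
  obtain ⟨G, hG⟩ := hS.exists_generator
  have h : ∀ x : SimpleClass C, x ∈ (objClass G).support := by
    intro x
    rw [Finsupp.mem_support_iff]
    intro h0
    have h1 := hS.objClass_mul_homDim G x
    rw [h0, zero_mul] at h1
    exact id_nonzero x.rep (hG x.rep (eq_zero_of_homDim h1.symm))
  exact Set.finite_univ_iff.1 ((objClass G).support.finite_toSet.subset fun x _ => h x)

/-- A real-valued function on objects which is additive on decompositions into simple objects
factors through the class. -/
theorem eq_sum_realClass_mul [Fintype (SimpleClass C)] (φ : C → ℝ)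
    (hφ : ∀ (V : C) (n : ℕ) (x : Fin n → SimpleClass C) (j : ∀ a, (x a).rep ⟶ V)
      (p : ∀ a, V ⟶ (x a).rep), IsDirectSum (fun a => (x a).rep) j p → φ V = ∑ a, φ (x a).rep)
    (V : C) : φ V = ∑ y, realClass V y * φ y.rep := by
  classical
  obtain ⟨n, x, j, p, hV⟩ := hS.exists_isDirectSum_rep V
  rw [hφ V n x j p hV, hS.realClass_isDirectSum hV]
  simp only [Finsupp.finsetSum_apply, Finset.sum_mul, hS.realClass_rep, Finsupp.single_apply]
  rw [Finset.sum_comm]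
  exact Finset.sum_congr rfl fun a _ => by simp

end IsSemisimpleCategory

end Classes

/-! ### The product of classes -/

section Product

variable {K : Type w} {C : Type u} [Field K] [Category.{v} C] [Abelian C] [Linear K C]
  [MonoidalCategory C]

theorem leftMul_apply [Fintype (SimpleClass C)] (a b : SimpleClass C →₀ ℝ) :
    leftMul a b = ∑ x, ∑ y, (a x * b y) • realClass (x.rep ⊗ y.rep) := by
  rw [leftMul, Finsupp.linearCombination_apply, Finsupp.sum_fintype _ _ (by simp),
    LinearMap.sum_apply]
  refine Finset.sum_congr rfl fun x _ => ?_
  rw [LinearMap.smul_apply, Finsupp.linearCombination_apply, Finsupp.sum_fintype _ _ (by simp),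
    Finset.smul_sum]
  exact Finset.sum_congr rfl fun y _ => smul_smul _ _ _

variable [MonoidalPreadditive C] (hS : IsSemisimpleCategory K C)
include hS

namespace IsSemisimpleCategory

theorem leftMul_realClass (V W : C) :
    leftMul (realClass V) (realClass W) = realClass (V ⊗ W) := by
  have := hS.finite_simpleClass
  let _ := Fintype.ofFinite (SimpleClass C)
  ext z
  rw [leftMul_apply, hS.eq_sum_realClass_mul (fun V => realClass (V ⊗ W) z)
    (fun V n x j p h => (DFunLike.congr_fun
      (hS.realClass_isDirectSum (h.map (tensorRight W))) z).trans (Finsupp.finsetSum_apply _ _ _)) V]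
  simp only [Finsupp.finsetSum_apply, Finsupp.smul_apply, smul_eq_mul]
  refine Finset.sum_congr rfl fun x _ => ?_
  rw [hS.eq_sum_realClass_mul (fun W => realClass (x.rep ⊗ W) z)
    (fun V n x' j p h => (DFunLike.congr_fun
      (hS.realClass_isDirectSum (h.map (tensorLeft x.rep))) z).trans
        (Finsupp.finsetSum_apply _ _ _)) W,
    Finset.mul_sum]
  exact Finset.sum_congr rfl fun y _ => mul_assoc _ _ _

theorem leftMul_assoc (a b c : SimpleClass C →₀ ℝ) :
    leftMul (leftMul a b) c = leftMul a (leftMul b c) := by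
  have h1 : ∀ (x : SimpleClass C) (r : ℝ), Finsupp.single x r = r • realClass x.rep := by
    intro x r
    rw [hS.realClass_rep]; simp
  induction a using Finsupp.induction_linear with
  | zero => simp
  | add a a' ha ha' => simp only [map_add, LinearMap.add_apply, ha, ha']
  | single x r =>
  induction b using Finsupp.induction_linear with
  | zero => simp
  | add a a' ha ha' => simp only [map_add, LinearMap.add_apply, ha, ha']
  | single y s =>
  induction c using Finsupp.induction_linear with
  | zero => simp
  | add a a' ha ha' => simp only [map_add, ha, ha']
  | single z t =>
  simp only [h1, map_smul, LinearMap.smul_apply, hS.leftMul_realClass,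
    hS.realClass_congr (α_ x.rep y.rep z.rep)]

theorem leftMul_unit : leftMul (realClass (𝟙_ C)) = LinearMap.id := by
  refine Finsupp.lhom_ext fun x r => ?_
  have : Finsupp.single x r = r • realClass x.rep := by rw [hS.realClass_rep]; simp
  rw [this, map_smul, map_smul, hS.leftMul_realClass, hS.realClass_congr (λ_ x.rep)]
  rfl

end IsSemisimpleCategory

end Product

/-! ### Perron-Frobenius theory -/

section Perron

variable {ι : Type*}

/-- Two vectors, the second strictly positive: the largest ratio of their coordinates is attained.
-/
theorem exists_le_smul [Finite ι] [Nonempty ι] (w v : ι → ℝ) (hv : ∀ i, 0 < v i) :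
    ∃ (c : ℝ) (i₀ : ι), (∀ i, w i ≤ c * v i) ∧ w i₀ = c * v i₀ := by
  obtain ⟨i₀, h⟩ := Finite.exists_max fun i => w i / v i
  exact ⟨w i₀ / v i₀, i₀, fun i => (div_le_iff₀ (hv i)).1 (h i), by
    rw [div_mul_cancel₀ _ (hv i₀).ne']⟩

/-- A strictly positive eigenvector of a linear map preserving non-negative vectors belongs to the
largest non-negative eigenvalue. -/
theorem isGreatest_of_pos_eigenvector [Finite ι] [Nonempty ι] (L : Module.End ℝ (ι →₀ ℝ))
    (hL : ∀ v : ι →₀ ℝ, (∀ i, 0 ≤ v i) → ∀ i, 0 ≤ L v i) {v : ι →₀ ℝ} (hv : ∀ i, 0 < v i) {l : ℝ}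
    (h : L v = l • v) : IsGreatest {r | 0 ≤ r ∧ L.HasEigenvalue r} l := by
  refine ⟨⟨?_, ?_⟩, ?_⟩
  · obtain ⟨i⟩ := ‹Nonempty ι›
    have h1 := hL v (fun i => (hv i).le) i
    rw [h, Finsupp.smul_apply, smul_eq_mul] at h1
    exact nonneg_of_mul_nonneg_left h1 (hv i)
  · refine Module.End.hasEigenvalue_of_hasEigenvector (x := v)
      ⟨Module.End.mem_eigenspace_iff.2 h, fun h0 => ?_⟩
    obtain ⟨i⟩ := ‹Nonempty ι›
    have := hv i
    simp [h0] at this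
  · rintro r ⟨hr, hev⟩
    obtain ⟨w, hw⟩ := hev.exists_hasEigenvector
    have hLw : L w = r • w := hw.apply_eq_smul
    let a : ι →₀ ℝ := w.mapRange abs abs_zero
    have ha : ∀ i, a i = |w i| := fun i => rfl
    obtain ⟨c, i₀, hc, hi₀⟩ := exists_le_smul a v hv
    have hcpos : 0 < c := by
      by_contra hneg
      refine hw.2 (Finsupp.ext fun i => ?_)
      have h1 : |w i| ≤ c * v i := hc i
      have h2 : c * v i ≤ 0 := mul_nonpos_of_nonpos_of_nonneg (not_lt.1 hneg) (hv i).le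
      simpa using abs_nonpos_iff.1 (h1.trans h2)
    have h1 : r * a i₀ ≤ L a i₀ := by
      have h2 := hL (a - w) (fun i => by
        rw [Finsupp.sub_apply, ha]; linarith [le_abs_self (w i)]) i₀
      have h3 := hL (a + w) (fun i => by
        rw [Finsupp.add_apply, ha]; linarith [neg_abs_le (w i)]) i₀
      rw [map_sub, hLw, Finsupp.sub_apply, Finsupp.smul_apply, smul_eq_mul] at h2
      rw [map_add, hLw, Finsupp.add_apply, Finsupp.smul_apply, smul_eq_mul] at h3
      rw [ha]
      rcases abs_cases (w i₀) with ⟨h4, -⟩ | ⟨h4, -⟩ <;> rw [h4] <;> linarith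
    have h2 := hL (c • v - a) (fun i => by
      rw [Finsupp.sub_apply, Finsupp.smul_apply, smul_eq_mul]; linarith [hc i]) i₀
    rw [map_sub, map_smul, h, Finsupp.sub_apply, Finsupp.smul_apply, Finsupp.smul_apply,
      smul_eq_mul, smul_eq_mul] at h2
    rw [hi₀] at h1
    have h3 : r * (c * v i₀) ≤ l * (c * v i₀) := by linarith
    exact le_of_mul_le_mul_right h3 (mul_pos hcpos (hv i₀))

/-- A strictly positive linear map has a strictly positive eigenvector. -/
theorem exists_pos_eigenvector [Fintype ι] [Nonempty ι] (L : Module.End ℝ (ι →₀ ℝ))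
    (hL : ∀ v : ι →₀ ℝ, (∀ i, 0 ≤ v i) → v ≠ 0 → ∀ i, 0 < L v i) :
    ∃ (v : ι →₀ ℝ) (l : ℝ), (∀ i, 0 < v i) ∧ L v = l • v := by
  classical
  let e := Finsupp.linearEquivFunOnFinite ℝ ℝ ι
  let T : (ι → ℝ) →ₗ[ℝ] (ι → ℝ) := e.toLinearMap ∘ₗ L ∘ₗ e.symm.toLinearMap
  have hT : ∀ v : ι → ℝ, (∀ i, 0 ≤ v i) → v ≠ 0 → ∀ i, 0 < T v i := by
    intro v hv h0 i
    exact hL (e.symm v) hv (by simpa using h0) i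
  suffices ∃ (v : ι → ℝ) (l : ℝ), (∀ i, 0 < v i) ∧ T v = l • v by
    obtain ⟨v, l, hv, h⟩ := this
    refine ⟨e.symm v, l, hv, e.injective ?_⟩
    rw [map_smul, e.apply_symm_apply]
    exact h
  have hTc : Continuous T := T.continuous_of_finiteDimensional
  have hcS : IsCompact (stdSimplex ℝ ι) := isCompact_stdSimplex ℝ ι
  have hS0 : ∀ v ∈ stdSimplex ℝ ι, v ≠ 0 := by
    rintro v ⟨-, hv⟩ rfl
    simp at hv
  have hTnn : ∀ v ∈ stdSimplex ℝ ι, ∀ i, 0 ≤ T v i := fun v hv i =>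
    (hT v hv.1 (hS0 v hv) i).le
  obtain ⟨B, hB⟩ := (hcS.image (f := fun v => ∑ i, T v i) (by fun_prop)).bddAbove
  have hB' : ∀ v ∈ stdSimplex ℝ ι, ∑ i, T v i ≤ B := fun v hv => hB ⟨v, hv, rfl⟩
  have hbound : ∀ v ∈ stdSimplex ℝ ι, ∀ t : ℝ, (∀ i, t * v i ≤ T v i) → t ≤ B := by
    intro v hv t ht
    have h1 : ∑ i, t * v i ≤ ∑ i, T v i := Finset.sum_le_sum fun i _ => ht i
    rw [← Finset.mul_sum, hv.2, mul_one] at h1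
    exact h1.trans (hB' v hv)
  -- maximize `t` over the pairs `(v, t)` with `v` in the simplex and `t v ≤ T v`
  let P : Set ((ι → ℝ) × ℝ) :=
    (stdSimplex ℝ ι ×ˢ Set.Icc 0 B) ∩ {q | ∀ i, q.2 * q.1 i ≤ T q.1 i}
  have hP : IsCompact P := by
    refine (hcS.prod isCompact_Icc).inter_right ?_
    simp only [Set.ofPred_forall]
    exact isClosed_iInter fun i => isClosed_le (by fun_prop) (by fun_prop)
  obtain ⟨i₁⟩ := ‹Nonempty ι›
  have hne : P.Nonempty := by
    have h1 := single_mem_stdSimplex ℝ i₁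
    have h2 : ∀ i, (0 : ℝ) * (Pi.single i₁ 1 : ι → ℝ) i ≤ T (Pi.single i₁ 1) i := fun i => by
      rw [zero_mul]; exact hTnn _ h1 i
    exact ⟨(Pi.single i₁ 1, 0), ⟨h1, le_rfl, hbound _ h1 0 h2⟩, h2⟩
  obtain ⟨⟨v, t⟩, ⟨⟨hvS, ht, -⟩, hvt⟩, hmax⟩ := hP.exists_isMaxOn hne continuous_snd.continuousOn
  simp only [Set.mem_ofPred_eq] at hvt hvS ht
  have hpos := hT v hvS.1 (hS0 v hvS)
  have heq : T v = t • v := by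
    by_contra hneq
    have h1 : ∀ i, 0 < T (T v - t • v) i := hT _ (fun i => by simpa using hvt i)
      (sub_ne_zero.2 hneq)
    let σ := ∑ i, T v i
    have hσ : 0 < σ := Finset.sum_pos (fun i _ => hpos i) ⟨i₁, Finset.mem_univ _⟩
    let u : ι → ℝ := σ⁻¹ • T v
    have hu : ∀ i, u i = σ⁻¹ * T v i := fun i => rfl
    have huS : u ∈ stdSimplex ℝ ι := by
      refine ⟨fun i => ?_, ?_⟩
      · rw [hu]; exact mul_nonneg (inv_nonneg.2 hσ.le) (hpos i).le
      · simp only [hu, ← Finset.mul_sum]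
        exact inv_mul_cancel₀ hσ.ne'
    have h2 : ∀ i, 0 < T u i - t * u i := by
      intro i
      have : T u i - t * u i = σ⁻¹ * T (T v - t • v) i := by
        simp only [u, map_smul, map_sub, Pi.smul_apply, Pi.sub_apply, smul_eq_mul]; ring
      rw [this]
      exact mul_pos (inv_pos.2 hσ) (h1 i)
    have : Nonempty ι := ⟨i₁⟩
    obtain ⟨i₂, hi₂⟩ := Finite.exists_min fun i => T u i - t * u i
    have h3 : ∀ i, (t + (T u i₂ - t * u i₂)) * u i ≤ T u i := by
      intro i
      have h4 : u i ≤ 1 := by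
        rw [← huS.2]; exact Finset.single_le_sum (fun j _ => huS.1 j) (Finset.mem_univ i)
      have h5 := mul_le_mul_of_nonneg_left h4 (h2 i₂).le
      have h6 := hi₂ i
      linarith
    have h7 := hmax (a := (u, t + (T u i₂ - t * u i₂)))
      ⟨⟨huS, by have := h2 i₂; dsimp only; linarith, hbound u huS _ h3⟩, h3⟩
    simp only [Set.mem_ofPred_eq] at h7
    linarith [h2 i₂]
  refine ⟨v, t, fun i => ?_, heq⟩
  have h1 := hpos i
  rw [heq, Pi.smul_apply, smul_eq_mul] at h1
  rcases pos_and_pos_or_neg_and_neg_of_mul_pos h1 with h2 | h2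
  · exact h2.2
  · linarith [h2.1]

/-- The positive eigenvector of a strictly positive linear map is unique up to scalars. -/
theorem eq_smul_of_eigenvector [Finite ι] [Nonempty ι] (L : Module.End ℝ (ι →₀ ℝ))
    (hL : ∀ v : ι →₀ ℝ, (∀ i, 0 ≤ v i) → v ≠ 0 → ∀ i, 0 < L v i) {v w : ι →₀ ℝ} {l : ℝ}
    (hv : ∀ i, 0 < v i) (h : L v = l • v) (hw : L w = l • w) : ∃ c : ℝ, w = c • v := by
  obtain ⟨c, i₀, hc, hi₀⟩ := exists_le_smul w v hv
  refine ⟨c, ?_⟩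
  by_contra hne
  have h1 := hL (c • v - w) (fun i => by
    rw [Finsupp.sub_apply, Finsupp.smul_apply, smul_eq_mul]; linarith [hc i])
    (sub_ne_zero.2 (Ne.symm hne)) i₀
  rw [map_sub, map_smul, h, hw, smul_comm, ← smul_sub, Finsupp.smul_apply, Finsupp.sub_apply,
    Finsupp.smul_apply, hi₀] at h1
  simp at h1

end Perron

/-! ### The Frobenius-Perron character -/

section Adjunction

variable {K : Type w} {C : Type u} [Field K] [Category.{v} C] [Abelian C] [Linear K C]
  [MonoidalCategory C] [MonoidalPreadditive C] [MonoidalLinear K C] [RigidCategory C]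

variable (K) in
/-- The adjunction between tensoring with an object and with its dual, on the left, as a linear
isomorphism of hom-spaces. -/
def dualTensorLinearEquiv (Y V W : C) : (Yᘁ ⊗ V ⟶ W) ≃ₗ[K] (V ⟶ Y ⊗ W) :=
  { tensorLeftHomEquiv V Y Yᘁ W with
    map_add' := fun f g => by simp [tensorLeftHomEquiv]
    map_smul' := fun c f => by simp [tensorLeftHomEquiv] }

variable (K) in
/-- The adjunction between tensoring with an object and with its dual, on the right, as a linear
isomorphism of hom-spaces. -/
def tensorDualLinearEquiv (V Y W : C) : (V ⊗ Y ⟶ W) ≃ₗ[K] (V ⟶ W ⊗ Yᘁ) :=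
  { tensorRightHomEquiv V Y Yᘁ W with
    map_add' := fun f g => by simp [tensorRightHomEquiv]
    map_smul' := fun c f => by simp [tensorRightHomEquiv] }

theorem homDim_dual_tensor (Y V W : C) : homDim K (Yᘁ ⊗ V) W = homDim K V (Y ⊗ W) :=
  (dualTensorLinearEquiv K Y V W).finrank_eq

theorem homDim_tensor_dual (V Y W : C) : homDim K (V ⊗ Y) W = homDim K V (W ⊗ Yᘁ) :=
  (tensorDualLinearEquiv K V Y W).finrank_eq

end Adjunction

namespace IsFusionCategory

variable {K : Type w} {C : Type u} [Field K] [Category.{v} C] [Abelian C] [Linear K C]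
  [MonoidalCategory C] [MonoidalPreadditive C] [MonoidalLinear K C] [RigidCategory C]
  (hC : IsFusionCategory K C)
include hC

theorem semisimple : IsSemisimpleCategory K C := hC.separable.isSemisimpleCategory

theorem finite_hom (V W : C) : Module.Finite K (V ⟶ W) := hC.semisimple.finite_hom V W

theorem finite_simpleClass : Finite (SimpleClass C) := hC.semisimple.finite_simpleClass

theorem nonempty_simpleClass : Nonempty (SimpleClass C) := ⟨SimpleClass.mk _ hC.simple_unit⟩

theorem leftMul_nonneg {a b : SimpleClass C →₀ ℝ} (ha : ∀ x, 0 ≤ a x) (hb : ∀ x, 0 ≤ b x)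
    (z : SimpleClass C) : 0 ≤ leftMul a b z := by
  have := hC.finite_simpleClass
  let _ := Fintype.ofFinite (SimpleClass C)
  rw [leftMul_apply]
  simp only [Finsupp.finsetSum_apply, Finsupp.smul_apply, smul_eq_mul]
  exact Finset.sum_nonneg fun x _ => Finset.sum_nonneg fun y _ =>
    mul_nonneg (mul_nonneg (ha x) (hb y)) (Nat.cast_nonneg _)

/-- A tensor product with the dual of a simple object is nonzero, because the unit object splits off
from `X ⊗ X*`. -/
theorem id_dual_tensor_ne_zero (x z : SimpleClass C) : 𝟙 ((x.rep)ᘁ ⊗ z.rep) ≠ 0 := by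
  intro h
  have := hC.simple_unit
  have hη : η_ x.rep (x.rep)ᘁ ≠ 0 := by
    intro h0
    have h1 := ExactPairing.evaluation_coevaluation (X := x.rep) (Y := (x.rep)ᘁ)
    rw [h0, MonoidalPreadditive.zero_whiskerRight, zero_comp] at h1
    refine id_nonzero x.rep ?_
    rw [← cancel_epi (λ_ x.rep).hom, ← cancel_mono (ρ_ x.rep).inv]
    simpa using h1.symm
  have := mono_of_nonzero_from_simple hη
  obtain ⟨g, hg⟩ := hC.semisimple.split (η_ x.rep (x.rep)ᘁ)
  have h2 : 𝟙 ((x.rep ⊗ (x.rep)ᘁ) ⊗ z.rep) = 0 := by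
    rw [← cancel_mono (α_ _ _ _).hom, Category.id_comp, ← Category.comp_id (α_ _ _ _).hom,
      ← whiskerLeft_id, h]
    simp
  have h3 : 𝟙 (𝟙_ C ⊗ z.rep) = 0 := by
    rw [← id_whiskerRight, ← hg, comp_whiskerRight, ← Category.id_comp (g ▷ z.rep), h2]
    simp
  refine id_nonzero z.rep ?_
  rw [← cancel_epi (λ_ z.rep).hom, Category.comp_id, ← Category.id_comp (λ_ z.rep).hom, h3]
  simp

/-- Transitivity: every simple object occurs in a product of a given one with a simple object. -/
theorem exists_realClass_tensor_pos (x z : SimpleClass C) :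
    ∃ y : SimpleClass C, 0 < realClass (x.rep ⊗ y.rep) z := by
  have hS := hC.semisimple
  have := hS.finite_hom
  have := hC.finite_simpleClass
  let _ := Fintype.ofFinite (SimpleClass C)
  have h1 : 0 < homDim K (x.rep ⊗ ((x.rep)ᘁ ⊗ z.rep)) z.rep := by
    rw [hS.homDim_comm, ← homDim_dual_tensor]
    exact homDim_pos_of_ne (hC.id_dual_tensor_ne_zero x z)
  have h2 : 0 < realClass (x.rep ⊗ ((x.rep)ᘁ ⊗ z.rep)) z := by
    have := hS.homDim_self_pos z
    rw [hS.realClass_apply]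
    positivity
  by_contra! hcon
  rw [← hS.leftMul_realClass, hS.realClass_rep, leftMul_apply] at h2
  simp only [Finsupp.finsetSum_apply, Finsupp.smul_apply, smul_eq_mul] at h2
  rw [Finset.sum_eq_single x (fun b _ hb => by simp [Finsupp.single_eq_of_ne hb])
    (by simp)] at h2
  refine absurd h2 (not_lt.2 (Finset.sum_nonpos fun y _ => ?_))
  rw [Finsupp.single_eq_same, one_mul]
  exact mul_nonpos_of_nonneg_of_nonpos (Nat.cast_nonneg _) (hcon y)

theorem leftMul_pos {a b : SimpleClass C →₀ ℝ} (ha : ∀ x, 0 ≤ a x) (ha0 : a ≠ 0)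
    (hb : ∀ x, 0 < b x) (z : SimpleClass C) : 0 < leftMul a b z := by
  have := hC.finite_simpleClass
  let _ := Fintype.ofFinite (SimpleClass C)
  obtain ⟨x, hx⟩ := Finsupp.ne_iff.1 ha0
  obtain ⟨y, hy⟩ := hC.exists_realClass_tensor_pos x z
  rw [leftMul_apply]
  simp only [Finsupp.finsetSum_apply, Finsupp.smul_apply, smul_eq_mul]
  have hnn : ∀ x y, 0 ≤ a x * b y * realClass (x.rep ⊗ y.rep) z := fun x y =>
    mul_nonneg (mul_nonneg (ha x) (hb y).le) (Nat.cast_nonneg _)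
  refine Finset.sum_pos' (fun x _ => Finset.sum_nonneg fun y _ => hnn x y)
    ⟨x, Finset.mem_univ _, Finset.sum_pos' (fun y _ => hnn x y) ⟨y, Finset.mem_univ _, ?_⟩⟩
  exact mul_pos (mul_pos (lt_of_le_of_ne (ha x) (Ne.symm hx)) (hb y)) hy

/-- Right multiplication by the sum of all simple classes is strictly positive and commutes with
left multiplications, so its Perron-Frobenius eigenvector is a common eigenvector of these. -/
theorem exists_character :
    ∃ (f : (SimpleClass C →₀ ℝ) →ₗ[ℝ] ℝ) (v : SimpleClass C →₀ ℝ),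
      (∀ x, 0 < v x) ∧ ∀ a, leftMul a v = f a • v := by
  have := hC.finite_simpleClass
  have := hC.nonempty_simpleClass
  let _ := Fintype.ofFinite (SimpleClass C)
  let S : SimpleClass C →₀ ℝ := Finsupp.equivFunOnFinite.symm fun _ => 1
  let T : Module.End ℝ (SimpleClass C →₀ ℝ) := leftMul.flip S
  have hT : ∀ b, T b = leftMul b S := fun b => rfl
  have hpos : ∀ b : SimpleClass C →₀ ℝ, (∀ i, 0 ≤ b i) → b ≠ 0 → ∀ i, 0 < T b i :=
    fun b hb hb0 i => hC.leftMul_pos hb hb0 (fun _ => one_pos) i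
  obtain ⟨v, l, hv, hl⟩ := exists_pos_eigenvector T hpos
  have hex : ∀ a, ∃ c : ℝ, leftMul a v = c • v := fun a => by
    refine eq_smul_of_eigenvector T hpos hv hl ?_
    rw [hT, hC.semisimple.leftMul_assoc, ← hT, hl, map_smul]
  obtain ⟨x₀⟩ := hC.nonempty_simpleClass
  refine ⟨(v x₀)⁻¹ • (Finsupp.lapply x₀ ∘ₗ leftMul.flip v), v, hv, fun a => ?_⟩
  obtain ⟨c, hc⟩ := hex a
  have h1 : ((v x₀)⁻¹ • (Finsupp.lapply x₀ ∘ₗ leftMul.flip v)) a = c := by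
    have := (hv x₀).ne'
    simp only [LinearMap.smul_apply, LinearMap.comp_apply, LinearMap.flip_apply,
      Finsupp.lapply_apply, hc, Finsupp.smul_apply, smul_eq_mul]
    field_simp
  rw [h1, hc]

/-- The Frobenius-Perron dimension as a linear functional: the eigenvalue of left multiplication on
the common positive eigenvector. -/
noncomputable def character : (SimpleClass C →₀ ℝ) →ₗ[ℝ] ℝ := hC.exists_character.choose

theorem exists_eigenvector : ∃ v : SimpleClass C →₀ ℝ,
    (∀ x, 0 < v x) ∧ ∀ a, leftMul a v = hC.character a • v :=
  hC.exists_character.choose_spec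

theorem character_leftMul (a b : SimpleClass C →₀ ℝ) :
    hC.character (leftMul a b) = hC.character a * hC.character b := by
  obtain ⟨v, hv, h⟩ := hC.exists_eigenvector
  obtain ⟨x⟩ := hC.nonempty_simpleClass
  have h1 := h (leftMul a b)
  rw [hC.semisimple.leftMul_assoc, h, map_smul, h, smul_smul] at h1
  have h2 := DFunLike.congr_fun h1 x
  simp only [Finsupp.smul_apply, smul_eq_mul] at h2
  rw [← mul_right_cancel₀ (hv x).ne' h2, mul_comm]

theorem isGreatest_character {a : SimpleClass C →₀ ℝ} (ha : ∀ x, 0 ≤ a x) :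
    IsGreatest (nonnegEigenvalues a) (hC.character a) := by
  have := hC.finite_simpleClass
  have := hC.nonempty_simpleClass
  obtain ⟨v, hv, h⟩ := hC.exists_eigenvector
  exact isGreatest_of_pos_eigenvector _ (fun b hb => hC.leftMul_nonneg ha hb) hv (h a)

theorem elemFPdim_eq {a : SimpleClass C →₀ ℝ} (ha : ∀ x, 0 ≤ a x) :
    elemFPdim a = hC.character a :=
  (hC.isGreatest_character ha).csSup_eq

theorem objFPdim_eq (V : C) : objFPdim V = hC.character (realClass V) :=
  hC.elemFPdim_eq (realClass_nonneg V)

theorem objFPdim_nonneg (V : C) : 0 ≤ objFPdim V := by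
  rw [hC.objFPdim_eq]
  exact (hC.isGreatest_character (realClass_nonneg V)).1.1

theorem objFPdim_congr {V W : C} (i : V ≅ W) : objFPdim V = objFPdim W := by
  rw [objFPdim, objFPdim, hC.semisimple.realClass_congr i]

theorem objFPdim_tensor (V W : C) : objFPdim (V ⊗ W) = objFPdim V * objFPdim W := by
  rw [hC.objFPdim_eq, ← hC.semisimple.leftMul_realClass, hC.character_leftMul, ← hC.objFPdim_eq,
    ← hC.objFPdim_eq]

theorem objFPdim_unit : objFPdim (𝟙_ C) = 1 := by
  obtain ⟨v, hv, h⟩ := hC.exists_eigenvector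
  obtain ⟨x⟩ := hC.nonempty_simpleClass
  have h1 := h (realClass (𝟙_ C))
  rw [hC.semisimple.leftMul_unit, ← hC.objFPdim_eq, LinearMap.id_apply] at h1
  have h2 := DFunLike.congr_fun h1 x
  rw [Finsupp.smul_apply, smul_eq_mul] at h2
  exact mul_right_cancel₀ (hv x).ne' (by rw [← h2, one_mul])

theorem objFPdim_rep_pos (x : SimpleClass C) : 0 < objFPdim x.rep := by
  obtain ⟨v, hv, h⟩ := hC.exists_eigenvector
  have h1 := hC.leftMul_pos (realClass_nonneg x.rep) (by
    rw [hC.semisimple.realClass_rep]; simp) hv x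
  rw [h, ← hC.objFPdim_eq, Finsupp.smul_apply, smul_eq_mul] at h1
  exact lt_of_le_of_ne (hC.objFPdim_nonneg _) fun h0 => by simp [← h0] at h1

theorem objFPdim_isDirectSum {ι : Type*} [Fintype ι] {X : ι → C}
    {V : C} {j : ∀ a, X a ⟶ V} {p : ∀ a, V ⟶ X a} (h : IsDirectSum X j p) :
    objFPdim V = ∑ a, objFPdim (X a) := by
  simp only [hC.objFPdim_eq, hC.semisimple.realClass_isDirectSum h, map_sum]

theorem objFPdim_isBinarySum {Y Z V : C} {i₁ : Y ⟶ V} {p₁ : V ⟶ Y} {i₂ : Z ⟶ V} {p₂ : V ⟶ Z}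
    (h : IsBinarySum i₁ p₁ i₂ p₂) : objFPdim V = objFPdim Y + objFPdim Z := by
  simp only [hC.objFPdim_eq, hC.semisimple.realClass_isBinarySum h, map_add]

theorem character_eq_sum [Fintype (SimpleClass C)] (a : SimpleClass C →₀ ℝ) :
    hC.character a = ∑ x, a x * objFPdim x.rep := by
  conv_lhs => rw [← Finsupp.univ_sum_single a]
  rw [map_sum]
  refine Finset.sum_congr rfl fun x _ => ?_
  have : Finsupp.single x (a x) = a x • realClass x.rep := by
    rw [hC.semisimple.realClass_rep]; simp
  rw [this, map_smul, hC.objFPdim_eq, smul_eq_mul]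

end IsFusionCategory

/-! ### The regular element -/

section Regular

variable (K : Type w) {C : Type u} [Field K] [Category.{v} C] [Abelian C] [Linear K C]
  [MonoidalCategory C]

/-- The coefficients of the regular element, up to normalization: `FPdim(X) / dim_K End(X)`. -/
noncomputable def regularCoeff (x : SimpleClass C) : ℝ :=
  objFPdim x.rep / homDim K x.rep x.rep

end Regular

namespace IsFusionCategory

variable {K : Type w} {C : Type u} [Field K] [Category.{v} C] [Abelian C] [Linear K C]
  [MonoidalCategory C] [MonoidalPreadditive C] [MonoidalLinear K C] [RigidCategory C]
  (hC : IsFusionCategory K C)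
include hC

theorem regularCoeff_pos (x : SimpleClass C) : 0 < regularCoeff K x :=
  div_pos (hC.objFPdim_rep_pos x) (Nat.cast_pos.2 (hC.semisimple.homDim_self_pos x))

variable [Fintype (SimpleClass C)]

/-- The Frobenius-Perron dimension is the pairing with the regular element. -/
theorem sum_regularCoeff_mul_homDim (V : C) :
    ∑ x, regularCoeff K x * homDim K V x.rep = objFPdim V := by
  rw [hC.objFPdim_eq, hC.character_eq_sum]
  refine Finset.sum_congr rfl fun x _ => ?_
  rw [hC.semisimple.realClass_apply, regularCoeff]
  ring

theorem sum_regularCoeff_mul_realClass_left (Y : C) (z : SimpleClass C) :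
    ∑ x, regularCoeff K x * realClass (Y ⊗ x.rep) z = objFPdim Yᘁ * regularCoeff K z := by
  simp only [hC.semisimple.realClass_apply, hC.semisimple.homDim_comm (Y ⊗ _),
    ← homDim_dual_tensor, mul_div_assoc', ← Finset.sum_div]
  rw [hC.sum_regularCoeff_mul_homDim, hC.objFPdim_tensor, regularCoeff, mul_div_assoc]

theorem sum_regularCoeff_mul_realClass_right (Y : C) (z : SimpleClass C) :
    ∑ x, regularCoeff K x * realClass (x.rep ⊗ Y) z = objFPdim Yᘁ * regularCoeff K z := by
  have h : ∀ x : SimpleClass C, realClass (x.rep ⊗ Y) z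
      = (homDim K (z.rep ⊗ Yᘁ) x.rep : ℝ) / homDim K z.rep z.rep := fun x => by
    rw [hC.semisimple.realClass_apply, homDim_tensor_dual, hC.semisimple.homDim_comm]
  simp only [h, mul_div_assoc', ← Finset.sum_div]
  rw [hC.sum_regularCoeff_mul_homDim, hC.objFPdim_tensor, regularCoeff, mul_comm, mul_div_assoc]

omit [Fintype (SimpleClass C)] in
/-- The regular element is a positive eigenvector of left multiplication by `Y`, with eigenvalue
`FPdim(Y*)`, which is therefore the largest eigenvalue. -/
theorem objFPdim_dual (Y : C) : objFPdim Yᘁ = objFPdim Y := by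
  have := hC.finite_simpleClass
  have := hC.nonempty_simpleClass
  let _ := Fintype.ofFinite (SimpleClass C)
  let s : SimpleClass C →₀ ℝ := Finsupp.equivFunOnFinite.symm (regularCoeff K)
  have hs : leftMul (realClass Y) s = objFPdim Yᘁ • s := by
    ext z
    have h1 : s = ∑ x, regularCoeff K x • realClass x.rep := by
      refine (Finsupp.univ_sum_single s).symm.trans (Finset.sum_congr rfl fun x _ => ?_)
      rw [hC.semisimple.realClass_rep, Finsupp.smul_single, smul_eq_mul, mul_one]
      rfl
    have hz : (objFPdim Yᘁ • s) z = objFPdim Yᘁ * regularCoeff K z := rfl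
    rw [hz, h1]
    simp only [map_sum, map_smul, hC.semisimple.leftMul_realClass]
    simpa [Finsupp.finsetSum_apply] using hC.sum_regularCoeff_mul_realClass_left Y z
  have h2 := isGreatest_of_pos_eigenvector (leftMul (realClass Y))
    (fun b hb => hC.leftMul_nonneg (realClass_nonneg Y) hb) (v := s) hC.regularCoeff_pos hs
  rw [hC.objFPdim_eq Y]
  exact h2.unique (hC.isGreatest_character (realClass_nonneg Y))

theorem sum_regularCoeff_mul_homDim_tensor (X N : C) :
    ∑ x, regularCoeff K x * homDim K N (X ⊗ x.rep) = objFPdim X * objFPdim N := by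
  simp only [← homDim_dual_tensor]
  rw [hC.sum_regularCoeff_mul_homDim, hC.objFPdim_tensor, hC.objFPdim_dual]

/-- The regular element absorbs right multiplication by a dual object, under every function on
objects that is additive on direct sums. -/
theorem sum_regularCoeff_mul_tensor_dual (φ : C → ℝ)
    (hφ : ∀ (V : C) (n : ℕ) (x : Fin n → SimpleClass C) (j : ∀ a, (x a).rep ⟶ V)
      (p : ∀ a, V ⟶ (x a).rep), IsDirectSum (fun a => (x a).rep) j p → φ V = ∑ a, φ (x a).rep)
    (Z : C) :
    ∑ x, regularCoeff K x * φ (x.rep ⊗ Zᘁ) =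
      objFPdim Z * ∑ x : SimpleClass C, regularCoeff K x * φ x.rep := by
  have h : ∀ x : SimpleClass C, regularCoeff K x * φ (x.rep ⊗ Zᘁ)
      = ∑ y, regularCoeff K x * realClass (x.rep ⊗ Zᘁ) y * φ y.rep := fun x => by
    rw [hC.semisimple.eq_sum_realClass_mul φ hφ (x.rep ⊗ Zᘁ), Finset.mul_sum]
    exact Finset.sum_congr rfl fun y _ => (mul_assoc _ _ _).symm
  rw [Finset.sum_congr rfl fun x _ => h x, Finset.sum_comm, Finset.mul_sum]
  refine Finset.sum_congr rfl fun y _ => ?_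
  rw [← Finset.sum_mul, hC.sum_regularCoeff_mul_realClass_right, hC.objFPdim_dual,
    hC.objFPdim_dual, mul_assoc]

end IsFusionCategory

/-! ### The left embedding -/

section LeftEmbedding

variable {C : Type u} [Category.{v} C] [Preadditive C] [MonoidalCategory C] [MonoidalPreadditive C]

theorem leftEmbedding_comp {V W : C} (e : End (𝟙_ C)) (f : V ⟶ W) :
    End.asHom (leftEmbedding V e) ≫ f = f ≫ End.asHom (leftEmbedding W e) := by
  change ((λ_ V).inv ≫ End.asHom e ▷ V ≫ (λ_ V).hom) ≫ f
    = f ≫ (λ_ W).inv ≫ End.asHom e ▷ W ≫ (λ_ W).hom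
  rw [Category.assoc, Category.assoc, ← leftUnitor_naturality, ← whisker_exchange_assoc,
    leftUnitor_inv_naturality_assoc]

theorem leftEmbedding_unit (e : End (𝟙_ C)) : leftEmbedding (𝟙_ C) e = e := by
  change (λ_ (𝟙_ C)).inv ≫ End.asHom e ▷ 𝟙_ C ≫ (λ_ (𝟙_ C)).hom = End.asHom e
  rw [unitors_equal, rightUnitor_naturality, ← unitors_equal, Iso.inv_hom_id_assoc]

theorem leftEmbedding_tensor (V W : C) (e : End (𝟙_ C)) :
    End.asHom (leftEmbedding (V ⊗ W) e) = End.asHom (leftEmbedding V e) ▷ W := by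
  change (λ_ (V ⊗ W)).inv ≫ End.asHom e ▷ (V ⊗ W) ≫ (λ_ (V ⊗ W)).hom
    = ((λ_ V).inv ≫ End.asHom e ▷ V ≫ (λ_ V).hom) ▷ W
  monoidal

theorem leftEmbedding_smul {K : Type w} [Field K] [Linear K C] [MonoidalLinear K C] (V : C)
    (c : K) : leftEmbedding V (c • 𝟙 (𝟙_ C) : 𝟙_ C ⟶ 𝟙_ C) = (c • 𝟙 V : V ⟶ V) := by
  change (λ_ V).inv ≫ (c • 𝟙 (𝟙_ C)) ▷ V ≫ (λ_ V).hom = c • 𝟙 V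
  simp

/-- `End(X)` has the same dimension over `K` as over `End(𝟙)` up to the factor `dim_K End(𝟙)`. -/
theorem homDim_unit_mul_dimEnd (K : Type w) [Field K] [HasKernels C] [Linear K C]
    [MonoidalLinear K C] [Simple (𝟙_ C)] (X : C) :
    homDim K (𝟙_ C) (𝟙_ C) * dimEnd X = homDim K X X := by
  let _ : Module (End (𝟙_ C)) (End X) := Module.compHom (End X) (leftEmbedding X)
  let _ : Module K (End (𝟙_ C)) := inferInstanceAs (Module K (𝟙_ C ⟶ 𝟙_ C))
  let _ : Module K (End X) := inferInstanceAs (Module K (X ⟶ X))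
  have : IsScalarTower K (End (𝟙_ C)) (End X) := ⟨fun c e f => by
    change f ≫ (λ_ X).inv ≫ (c • End.asHom e) ▷ X ≫ (λ_ X).hom
      = c • (f ≫ (λ_ X).inv ≫ End.asHom e ▷ X ≫ (λ_ X).hom)
    simp⟩
  exact Module.finrank_mul_finrank K (End (𝟙_ C)) (End X)

end LeftEmbedding

/-! ### Objects with an action of an endomorphism algebra -/

section EndModule

variable {C : Type u} [Category.{v} C] [Preadditive C] [MonoidalCategory C] [MonoidalPreadditive C]

/-- An object with an action of the monoid `End(X)` is an `End(X)`-module if the action is additive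
and the subring `End(𝟙)` acts through the left embedding. -/
structure IsEndModule {X : C} (N : Action C (End X)) : Prop where
  map_add : ∀ d d' : End X, N.ρ (d + d') = N.ρ d + N.ρ d'
  map_leftEmbedding : ∀ e : End (𝟙_ C), N.ρ (leftEmbedding X e) = leftEmbedding N.V e

theorem Action.isEndModule_of_retract {X : C} {N T : Action C (End X)} (hN : IsEndModule N)
    {i : T ⟶ N} {p : N ⟶ T} (h : i ≫ p = 𝟙 T) : IsEndModule T := by
  have h0 : i.hom ≫ p.hom = 𝟙 T.V := congrArg Action.Hom.hom h
  have h1 : ∀ d, T.ρ d = i.hom ≫ End.asHom (N.ρ d) ≫ p.hom := fun d => by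
    have h2 := p.comm d
    change _ = i.hom ≫ N.ρ d ≫ p.hom
    rw [h2, reassoc_of% h0]
  refine ⟨fun d d' => ?_, fun e => ?_⟩
  · rw [h1, h1, h1, hN.map_add]
    change i.hom ≫ (End.asHom (N.ρ d) + End.asHom (N.ρ d')) ≫ p.hom = _
    rw [Preadditive.add_comp, Preadditive.comp_add]
  · rw [h1, hN.map_leftEmbedding, leftEmbedding_comp, reassoc_of% h0]

/-- The object `X` with the tautological action of `End(X)`. -/
@[simps]
def selfAction (X : C) : Action C (End X) where
  V := X
  ρ := MonoidHom.id _

theorem isEndModule_selfAction (X : C) : IsEndModule (selfAction X) :=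
  ⟨fun _ _ => rfl, fun _ => rfl⟩

/-- The action on `N ⊗ Z` through the first factor. -/
def tensorAction {X : C} (N : Action C (End X)) (Z : C) : Action C (End X) where
  V := N.V ⊗ Z
  ρ :=
    { toFun := fun d => End.asHom (N.ρ d) ▷ Z
      map_one' := by rw [map_one]; exact id_whiskerRight _ _
      map_mul' := fun d d' => by rw [map_mul]; simp [End.asHom, End.mul_def] }

theorem isEndModule_tensorAction {X : C} {N : Action C (End X)} (hN : IsEndModule N) (Z : C) :
    IsEndModule (tensorAction N Z) := by
  refine ⟨fun d d' => ?_, fun e => ?_⟩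
  · change End.asHom (N.ρ (d + d')) ▷ Z = End.asHom (N.ρ d) ▷ Z + End.asHom (N.ρ d') ▷ Z
    rw [hN.map_add]
    exact MonoidalPreadditive.add_whiskerRight _ _
  · change End.asHom (N.ρ (leftEmbedding X e)) ▷ Z = _
    rw [hN.map_leftEmbedding]
    exact (leftEmbedding_tensor _ _ _).symm

/-- The functor `W ↦ X ⊗ W` to objects with an action of `End(X)`. -/
def selfTensor (X : C) : C ⥤ Action C (End X) where
  obj W := tensorAction (selfAction X) W
  map f := { hom := X ◁ f, comm := fun d => (whisker_exchange (End.asHom d) f).symm }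

instance (X : C) : (selfTensor X).Additive where
  map_add {_ _ f g} := Action.Hom.ext (MonoidalPreadditive.whiskerLeft_add (X := X) f g)

variable (K : Type w) [Field K] [Linear K C]

omit [MonoidalCategory C] [MonoidalPreadditive C] in
theorem finite_hom_action (hfin : ∀ V W : C, Module.Finite K (V ⟶ W)) {G : Type*} [Monoid G]
    (N V : Action C G) : Module.Finite K (N ⟶ V) :=
  have := hfin N.V V.V
  Module.Finite.of_injective ((Action.forget C G).mapLinearMap K)
    fun _ _ h => Action.Hom.ext h

omit [MonoidalCategory C] [MonoidalPreadditive C] in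
theorem homDim_action_le (hfin : ∀ V W : C, Module.Finite K (V ⟶ W)) {G : Type*} [Monoid G]
    (N V : Action C G) : homDim K N V ≤ homDim K N.V V.V :=
  have := hfin N.V V.V
  LinearMap.finrank_le_finrank_of_injective (f := (Action.forget C G).mapLinearMap K)
    fun _ _ h => Action.Hom.ext h

omit [MonoidalCategory C] [MonoidalPreadditive C] in
variable {K} in
theorem homDim_action_congr {G : Type*} [Monoid G]
    (N V N' V' : Action C G) (e : (N.V ⟶ V.V) ≃ₗ[K] (N'.V ⟶ V'.V))
    (h : ∀ f d, End.asHom (N.ρ d) ≫ f = f ≫ End.asHom (V.ρ d) ↔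
      End.asHom (N'.ρ d) ≫ e f = e f ≫ End.asHom (V'.ρ d)) :
    homDim K N V = homDim K N' V' :=
  LinearEquiv.finrank_eq
    { toFun := fun f => ⟨e f.hom, fun d => (h _ d).1 (f.comm d)⟩
      invFun := fun f => ⟨e.symm f.hom, fun d => (h _ d).2 (by
        rw [e.apply_symm_apply]; exact f.comm d)⟩
      map_add' := fun f g => Action.Hom.ext (map_add e f.hom g.hom)
      map_smul' := fun c f => Action.Hom.ext (map_smul e c f.hom)
      left_inv := fun f => Action.Hom.ext (e.symm_apply_apply f.hom)
      right_inv := fun f => Action.Hom.ext (e.apply_symm_apply f.hom) }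

end EndModule

section EndModuleRigid

variable {K : Type w} {C : Type u} [Field K] [Category.{v} C] [Abelian C] [Linear K C]
  [MonoidalCategory C] [MonoidalPreadditive C] [MonoidalLinear K C] [RigidCategory C]

theorem homDim_tensorAction {X : C} (N : Action C (End X)) (Z W : C) :
    homDim K (tensorAction N Z) ((selfTensor X).obj W)
      = homDim K N ((selfTensor X).obj (W ⊗ Zᘁ)) := by
  let e := tensorRightHomEquiv N.V Z Zᘁ (X ⊗ W)
  have h1 : ∀ d (h : N.V ⊗ Z ⟶ X ⊗ W), e (End.asHom (N.ρ d) ▷ Z ≫ h) = End.asHom (N.ρ d) ≫ e h := by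
    intro d h
    rw [← Equiv.eq_symm_apply, tensorRightHomEquiv_symm_naturality, Equiv.symm_apply_apply]
  have h2 : ∀ (d : End X) (h : N.V ⊗ Z ⟶ X ⊗ W), e (h ≫ End.asHom d ▷ W)
      = e h ≫ (End.asHom d ▷ W) ▷ Zᘁ := fun d h => tensorRightHomEquiv_naturality _ _
  let E : (N.V ⊗ Z ⟶ X ⊗ W) ≃ₗ[K] (N.V ⟶ X ⊗ (W ⊗ Zᘁ)) :=
    tensorDualLinearEquiv K N.V Z (X ⊗ W) ≪≫ₗ Linear.homCongr K (Iso.refl _) (α_ X W Zᘁ)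
  have h3 : ∀ h, E h = e h ≫ (α_ X W Zᘁ).hom := fun h =>
    (Linear.homCongr_apply K _ _ _).trans (congrArg (· ≫ _) (Category.id_comp _))
  have key : ∀ (h : N.V ⊗ Z ⟶ X ⊗ W) (d : End X),
      End.asHom (N.ρ d) ▷ Z ≫ h = h ≫ End.asHom d ▷ W ↔
        End.asHom (N.ρ d) ≫ E h = E h ≫ End.asHom d ▷ (W ⊗ Zᘁ) := fun h d => by
    rw [h3, ← e.apply_eq_iff_eq, h1, h2, ← cancel_mono (α_ X W Zᘁ).hom]
    simp
  exact homDim_action_congr (tensorAction N Z) ((selfTensor X).obj W) N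
    ((selfTensor X).obj (W ⊗ Zᘁ)) E key

end EndModuleRigid

/-! ### Splitting off the unit object -/

section Split

variable {C : Type u} [Category.{v} C]

/-- Grouping the summands of a direct sum according to a predicate. -/
theorem IsDirectSum.isBinarySum [Preadditive C] [HasFiniteBiproducts C] {ι : Type*} [Fintype ι]
    {X : ι → C} {V : C}
    {j : ∀ a, X a ⟶ V} {p : ∀ a, V ⟶ X a} (h : IsDirectSum X j p) (P : ι → Prop) :
    IsBinarySum (biproduct.desc fun a : {a // P a} => j a) (biproduct.lift fun a => p a)
      (biproduct.desc fun a : {a // ¬ P a} => j a) (biproduct.lift fun a => p a) := by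
  classical
  have key : ∀ (Q : ι → Prop),
      (biproduct.desc fun a : {a // Q a} => j a) ≫ (biproduct.lift fun a : {a // Q a} => p a)
        = 𝟙 _ := by
    intro Q
    ext b a
    rcases eq_or_ne a b with rfl | hab
    · simp [h.self]
    · simp [h.ne _ _ (Subtype.coe_injective.ne hab), biproduct.ι_π_ne _ hab]
  have key' : ∀ (Q R : ι → Prop), (∀ a, Q a → ¬ R a) →
      (biproduct.desc fun a : {a // Q a} => j a) ≫ (biproduct.lift fun a : {a // R a} => p a)
        = 0 := by
    intro Q R hQR
    ext b a
    have : (a : ι) ≠ b := fun hab => hQR a a.2 (hab ▸ b.2)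
    simp [h.ne _ _ this]
  have key'' : ∀ (Q : ι → Prop),
      (biproduct.lift fun a : {a // Q a} => p a) ≫ (biproduct.desc fun a : {a // Q a} => j a)
        = ∑ a : {a // Q a}, p a ≫ j a := by
    intro Q
    have : ∀ a : {a // Q a}, (biproduct.lift fun a : {a // Q a} => p a) ≫
        (biproduct.π (fun a : {a // Q a} => X a) a ≫ biproduct.ι (fun a : {a // Q a} => X a) a) ≫
          (biproduct.desc fun a : {a // Q a} => j a)
          = p a ≫ j a := fun a => by simp
    rw [← Finset.sum_congr rfl fun a _ => this a, ← Preadditive.comp_sum, ← Preadditive.sum_comp,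
      sum_biproduct_π_ι, Category.id_comp]
  refine ⟨key P, key _, key' _ _ fun a ha ha' => ha' ha, key' _ _ fun a ha ha' => ha ha', ?_⟩
  rw [key'', key'', ← h.total]
  convert Fintype.sum_subtype_add_sum_subtype P fun a => p a ≫ j a

variable {K : Type w} [Field K] [Abelian C] [Linear K C]

/-- In a semisimple category, every object is the sum of multiples of a given simple object and an
object which has no nonzero maps to or from these. -/
theorem IsSemisimpleCategory.exists_isotypic (hS : IsSemisimpleCategory K C) {U : C} (hU : Simple U)
    (V : C) :
    ∃ (T M : C) (i : T ⟶ V) (p : V ⟶ T) (i' : M ⟶ V) (p' : V ⟶ M), IsBinarySum i p i' p' ∧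
      (∃ (ι : Type) (_ : Fintype ι) (j : ι → (U ⟶ T)) (q : ι → (T ⟶ U)),
        IsDirectSum (fun _ : ι => U) j q) ∧
      (∀ f : T ⟶ M, f = 0) ∧ (∀ f : M ⟶ T, f = 0) ∧ ∀ f : U ⟶ M, f = 0 := by
  classical
  obtain ⟨n, x, j, p, h⟩ := hS.exists_isDirectSum_rep V
  obtain ⟨e⟩ := SimpleClass.nonempty_rep_iso hU
  let u := SimpleClass.mk U hU
  have h1 : ∀ f : U ⟶ ⨁ (fun a : {a // ¬ x a = u} => (x a).rep), f = 0 := by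
    intro f
    rw [← cancel_epi e.hom, comp_zero]
    ext a
    rw [zero_comp]
    exact SimpleClass.hom_eq_zero (Ne.symm a.2) _
  have h2 := IsDirectSum.of_iso (Iso.refl (⨁ (fun a : {a // x a = u} => (x a).rep)))
  have e' : ∀ a : {a // x a = u}, (x a).rep ≅ U := fun a => eqToIso (by rw [a.2]) ≪≫ e
  refine ⟨_, _, _, _, _, _, h.isBinarySum (fun a => x a = u), ⟨_, inferInstance,
    fun a => (e' a).inv ≫ biproduct.ι (fun a : {a // x a = u} => (x a).rep) a,
    fun a => biproduct.π (fun a : {a // x a = u} => (x a).rep) a ≫ (e' a).hom, ?_⟩, ?_, ?_, h1⟩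
  · refine ⟨fun a => by simp, fun a b hab => by simp [biproduct.ι_π_ne_assoc _ hab], ?_⟩
    rw [← sum_biproduct_π_ι]
    exact Finset.sum_congr rfl fun a _ => by simp
  · intro f
    ext b a
    simpa using SimpleClass.hom_eq_zero (fun h => b.2 (h.symm.trans a.2))
      (biproduct.ι (fun a : {a // x a = u} => (x a).rep) a ≫ f ≫ biproduct.π _ b)
  · intro f
    ext b a
    simpa using SimpleClass.hom_eq_zero (fun h => a.2 (h.trans b.2))
      (biproduct.ι (fun a : {a // ¬ x a = u} => (x a).rep) a ≫ f ≫ biproduct.π _ b)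

/-- The summand `T` of an object with an action inherits the action, if there are no nonzero maps
from `T` to its complement. -/
def summandAction {G : Type*} [Monoid G] (N : Action C G) {T M : C} {i : T ⟶ N.V} {p : N.V ⟶ T}
    {i' : M ⟶ N.V} {p' : N.V ⟶ M} (h : IsBinarySum i p i' p') (h0 : ∀ f : T ⟶ M, f = 0) :
    Action C G where
  V := T
  ρ :=
    { toFun := fun d => i ≫ End.asHom (N.ρ d) ≫ p
      map_one' := by
        rw [map_one]
        change i ≫ 𝟙 _ ≫ p = 𝟙 _
        rw [Category.id_comp, h.self₁]
      map_mul' := fun d d' => by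
        rw [map_mul]
        change i ≫ (End.asHom (N.ρ d') ≫ End.asHom (N.ρ d)) ≫ p
          = (i ≫ End.asHom (N.ρ d') ≫ p) ≫ i ≫ End.asHom (N.ρ d) ≫ p
        have h1 := h0 (i ≫ End.asHom (N.ρ d') ≫ p')
        have h2 : End.asHom (N.ρ d') = End.asHom (N.ρ d') ≫ (p ≫ i + p' ≫ i') := by
          rw [h.total, Category.comp_id]
        conv_lhs => rw [h2]
        simp only [Preadditive.comp_add, Preadditive.add_comp, Category.assoc]
        rw [reassoc_of% h1, zero_comp, add_zero] }

/-- A decomposition whose two summands admit no nonzero maps between them is respected by every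
action. -/
theorem exists_isBinarySum_action {G : Type*} [Monoid G] (N : Action C G) {T M : C} {i : T ⟶ N.V}
    {p : N.V ⟶ T} {i' : M ⟶ N.V} {p' : N.V ⟶ M} (h : IsBinarySum i p i' p')
    (h0 : ∀ f : T ⟶ M, f = 0) (h0' : ∀ f : M ⟶ T, f = 0) :
    ∃ (T' M' : Action C G) (i₁ : T' ⟶ N) (p₁ : N ⟶ T') (i₂ : M' ⟶ N) (p₂ : N ⟶ M'),
      IsBinarySum i₁ p₁ i₂ p₂ ∧ T'.V = T ∧ M'.V = M := by
  have h' : IsBinarySum i' p' i p := ⟨h.self₂, h.self₁, h.ne₂, h.ne₁, by rw [add_comm, h.total]⟩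
  have key : ∀ {T M : C} {i : T ⟶ N.V} {p : N.V ⟶ T} {i' : M ⟶ N.V} {p' : N.V ⟶ M}
      (_ : IsBinarySum i p i' p') (_ : ∀ f : T ⟶ M, f = 0) (d : G),
      (i ≫ End.asHom (N.ρ d) ≫ p) ≫ i = i ≫ End.asHom (N.ρ d) := by
    intro T M i p i' p' h h0 d
    have h1 := h0 (i ≫ End.asHom (N.ρ d) ≫ p')
    conv_rhs => rw [← Category.comp_id (End.asHom (N.ρ d)), ← h.total]
    simp only [Preadditive.comp_add, Category.assoc]
    rw [reassoc_of% h1, zero_comp, add_zero]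
  have key' : ∀ {T M : C} {i : T ⟶ N.V} {p : N.V ⟶ T} {i' : M ⟶ N.V} {p' : N.V ⟶ M}
      (_ : IsBinarySum i p i' p') (_ : ∀ f : M ⟶ T, f = 0) (d : G),
      End.asHom (N.ρ d) ≫ p = p ≫ i ≫ End.asHom (N.ρ d) ≫ p := by
    intro T M i p i' p' h h0 d
    have h1 := h0 (i' ≫ End.asHom (N.ρ d) ≫ p)
    conv_lhs => rw [← Category.id_comp (End.asHom (N.ρ d)), ← h.total]
    simp only [Preadditive.add_comp, Category.assoc]
    rw [h1, comp_zero, add_zero]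
  refine ⟨summandAction N h h0, summandAction N h' h0', ⟨i, key h h0⟩, ⟨p, key' h h0'⟩,
    ⟨i', key h' h0'⟩, ⟨p', key' h' h0⟩, ⟨?_, ?_, ?_, ?_, ?_⟩, rfl, rfl⟩
  · ext; exact h.self₁
  · ext; exact h.self₂
  · ext; exact h.ne₁
  · ext; exact h.ne₂
  · ext; exact h.total

end Split

/-! ### Counting equivariant maps -/

section Isotypic

variable {K : Type w} {C : Type u} [Field K] [Category.{v} C] [Abelian C] [Linear K C]
  [MonoidalCategory C] [MonoidalPreadditive C] [MonoidalLinear K C]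

/-- The additive monoid action of an `End(X)`-module as a ring homomorphism. -/
def IsEndModule.ringHom {X : C} {N : Action C (End X)} (hN : IsEndModule N) :
    End X →+* End N.V :=
  RingHom.mk' N.ρ hN.map_add

/-- If `T` is a multiple of the unit object, then maps of `End(X)`-modules `T ⟶ V` correspond to
`End(X)`-linear maps `Hom(𝟙, T) → Hom(𝟙, V)` of vector spaces over the division ring `End(X)`. -/
theorem homDim_action_mul_of_isDirectSum_unit (hfin : ∀ V W : C, Module.Finite K (V ⟶ W)) {X : C}
    [Simple X] {T V : Action C (End X)} (hT : IsEndModule T) (hV : IsEndModule V)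
    {ι : Type*} [Fintype ι] {j : ι → (𝟙_ C ⟶ T.V)} {q : ι → (T.V ⟶ 𝟙_ C)}
    (h : IsDirectSum (fun _ : ι => 𝟙_ C) j q) :
    homDim K T V * homDim K X X = homDim K (𝟙_ C) T.V * homDim K (𝟙_ C) V.V := by
  let P := 𝟙_ C ⟶ T.V
  let P' := 𝟙_ C ⟶ V.V
  let _ : Module (End X) P := Module.compHom (𝟙_ C ⟶ T.V) hT.ringHom
  let _ : Module (End X) P' := Module.compHom (𝟙_ C ⟶ V.V) hV.ringHom
  let _ : Module K (End X) := inferInstanceAs (Module K (X ⟶ X))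
  have : Module.Finite K P := hfin _ _
  have : Module.Finite K P' := hfin _ _
  have hsmul : ∀ (d : End X) (p : P), d • p = p ≫ End.asHom (T.ρ d) := fun _ _ => rfl
  have hsmul' : ∀ (d : End X) (p : P'), d • p = p ≫ End.asHom (V.ρ d) := fun _ _ => rfl
  -- scalars act through the left embedding of `c • 𝟙`
  have hK : ∀ {N : Action C (End X)} (_ : IsEndModule N) (c : K) (d : End X),
      End.asHom (N.ρ (c • d)) = c • End.asHom (N.ρ d) := by
    intro N hN c d
    have h1 : (c • d : End X)
        = leftEmbedding X (c • 𝟙 (𝟙_ C) : 𝟙_ C ⟶ 𝟙_ C) * d := by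
      rw [leftEmbedding_smul]
      change c • End.asHom d = End.asHom d ≫ (c • 𝟙 X)
      simp
    rw [h1, map_mul, hN.map_leftEmbedding, leftEmbedding_smul]
    change End.asHom (N.ρ d) ≫ (c • 𝟙 N.V) = _
    simp
  have hst : IsScalarTower K (End X) P := ⟨fun c d p => by
    rw [hsmul, hK hT, Linear.comp_smul, hsmul]⟩
  have hcomm : SMulCommClass (End X) K P' := ⟨fun d c p => by
    rw [hsmul', hsmul', Linear.smul_comp]⟩
  have hE : ∀ {N : Action C (End X)} (_ : IsEndModule N) (e : 𝟙_ C ⟶ 𝟙_ C) (p : 𝟙_ C ⟶ N.V),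
      e ≫ p = p ≫ End.asHom (N.ρ (leftEmbedding X e)) := by
    intro N hN e p
    rw [hN.map_leftEmbedding, ← leftEmbedding_comp, leftEmbedding_unit]
  -- a linear map of the hom-spaces extends to a morphism because it commutes with `End(𝟙)`
  have hext : ∀ (φ : P →ₗ[End X] P') (p : P), p ≫ ∑ a, q a ≫ φ (j a) = φ p := by
    intro φ p
    have h1 : p = ∑ a, (p ≫ q a) ≫ j a := by
      simp only [Category.assoc]
      rw [← Preadditive.comp_sum, h.total, Category.comp_id]
    conv_rhs => rw [h1, map_sum]
    rw [Preadditive.comp_sum]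
    refine Finset.sum_congr rfl fun a _ => ?_
    rw [hE hT, ← hsmul, map_smul, hsmul', ← hE hV, Category.assoc]
  let e : (T ⟶ V) ≃ₗ[K] (P →ₗ[End X] P') :=
    { toFun := fun f =>
        { toFun := fun p => p ≫ f.hom
          map_add' := fun p p' => Preadditive.add_comp _ _ _ _ _ _
          map_smul' := fun d p => by
            have := f.comm d
            change (p ≫ T.ρ d) ≫ f.hom = (p ≫ f.hom) ≫ V.ρ d
            rw [Category.assoc, this, Category.assoc] }
      map_add' := fun f g => LinearMap.ext fun p => Preadditive.comp_add _ _ _ _ _ _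
      map_smul' := fun c f => LinearMap.ext fun p => Linear.comp_smul _ _ _ _ _ _
      invFun := fun φ =>
        { hom := ∑ a, q a ≫ φ (j a)
          comm := fun d => by
            have key : ∀ b, j b ≫ T.ρ d ≫ ∑ a, q a ≫ φ (j a)
                = j b ≫ (∑ a, q a ≫ φ (j a)) ≫ V.ρ d := by
              intro b
              have h2 : φ (j b ≫ T.ρ d) = φ (j b) ≫ V.ρ d := φ.map_smul d (j b)
              rw [← Category.assoc, hext φ, h2, ← Category.assoc, hext φ]
            rw [← Category.id_comp (T.ρ d ≫ _), ← h.total, Preadditive.sum_comp,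
              ← Category.id_comp ((∑ a, q a ≫ φ (j a)) ≫ V.ρ d), ← h.total, Preadditive.sum_comp]
            refine Finset.sum_congr rfl fun b _ => ?_
            rw [Category.assoc, key, Category.assoc] }
      left_inv := fun f => by
        ext
        change ∑ a, q a ≫ j a ≫ f.hom = f.hom
        simp only [← Category.assoc]
        rw [← Preadditive.sum_comp, h.total, Category.id_comp]
      right_inv := fun φ => LinearMap.ext fun p => hext φ p }
  have : Module.Finite (End X) P := Module.Finite.of_restrictScalars_finite K (End X) P
  let b := Module.finBasis (End X) P
  have h1 : homDim K T V = Module.finrank (End X) P * homDim K (𝟙_ C) V.V := by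
    have h2 := (e ≪≫ₗ (b.constr K (M' := P')).symm).finrank_eq
    rw [Module.finrank_pi_fintype, Finset.sum_const, Finset.card_univ, Fintype.card_fin,
      smul_eq_mul] at h2
    exact h2
  have h3 : homDim K X X * Module.finrank (End X) P = homDim K (𝟙_ C) T.V :=
    Module.finrank_mul_finrank K (End X) P
  rw [h1, ← h3]
  ring

end Isotypic

/-! ### The dimension of the space of equivariant maps, weighted by the regular element -/

namespace IsFusionCategory

variable {K : Type w} {C : Type u} [Field K] [Category.{v} C] [Abelian C] [Linear K C]
  [MonoidalCategory C] [MonoidalPreadditive C] [MonoidalLinear K C] [RigidCategory C]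

variable (K) in
/-- The Frobenius-Perron dimension of `X* ⊗_{End(X)} N`, expressed as a count of equivariant maps
`N ⟶ X ⊗ W` for simple `W`, weighted by the regular element. -/
noncomputable def weightedHom [Fintype (SimpleClass C)] (X : C) (N : Action C (End X)) : ℝ :=
  ∑ x : SimpleClass C, regularCoeff K x * homDim K N ((selfTensor X).obj x.rep)

variable (hC : IsFusionCategory K C) [Fintype (SimpleClass C)] {X : C}
include hC

theorem weightedHom_nonneg (N : Action C (End X)) : 0 ≤ weightedHom K X N :=
  Finset.sum_nonneg fun x _ => mul_nonneg (hC.regularCoeff_pos x).le (Nat.cast_nonneg _)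

theorem weightedHom_le (N : Action C (End X)) :
    weightedHom K X N ≤ objFPdim X * objFPdim N.V := by
  rw [← hC.sum_regularCoeff_mul_homDim_tensor]
  exact Finset.sum_le_sum fun x _ => mul_le_mul_of_nonneg_left
    (Nat.cast_le.2 (homDim_action_le K hC.finite_hom _ _)) (hC.regularCoeff_pos x).le

theorem weightedHom_isBinarySum {N T M : Action C (End X)} {i₁ : T ⟶ N} {p₁ : N ⟶ T} {i₂ : M ⟶ N}
    {p₂ : N ⟶ M} (h : IsBinarySum i₁ p₁ i₂ p₂) :
    weightedHom K X N = weightedHom K X T + weightedHom K X M := by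
  have : ∀ N V : Action C (End X), Module.Finite K (N ⟶ V) := finite_hom_action K hC.finite_hom
  simp only [weightedHom, h.homDim_left, Nat.cast_add, mul_add, Finset.sum_add_distrib]

theorem weightedHom_tensor (N : Action C (End X)) (Z : C) :
    weightedHom K X (tensorAction N Z) = objFPdim Z * weightedHom K X N := by
  have : ∀ N V : Action C (End X), Module.Finite K (N ⟶ V) := finite_hom_action K hC.finite_hom
  simp only [weightedHom, homDim_tensorAction]
  exact hC.sum_regularCoeff_mul_tensor_dual
    (fun W => (homDim K N ((selfTensor X).obj W) : ℝ))
    (fun V n x j p h => by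
      rw [(h.map (selfTensor X)).homDim_right, Nat.cast_sum]) Z

omit [Fintype (SimpleClass C)] in
theorem objFPdim_of_isDirectSum_unit {T : C} {ι : Type*} [Fintype ι] {j : ι → (𝟙_ C ⟶ T)}
    {q : ι → (T ⟶ 𝟙_ C)} (h : IsDirectSum (fun _ : ι => 𝟙_ C) j q) :
    (homDim K (𝟙_ C) T : ℝ) = objFPdim T * homDim K (𝟙_ C) (𝟙_ C) := by
  have := hC.finite_hom
  rw [h.homDim_right, hC.objFPdim_isDirectSum h, hC.objFPdim_unit]
  simp

theorem weightedHom_of_isDirectSum_unit [Simple X] {T : Action C (End X)} (hT : IsEndModule T)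
    {ι : Type*} [Fintype ι] {j : ι → (𝟙_ C ⟶ T.V)}
    {q : ι → (T.V ⟶ 𝟙_ C)} (h : IsDirectSum (fun _ : ι => 𝟙_ C) j q) :
    weightedHom K X T * homDim K X X
      = objFPdim X * objFPdim T.V * homDim K (𝟙_ C) (𝟙_ C) := by
  have h1 : ∀ x : SimpleClass C,
      regularCoeff K x * homDim K T ((selfTensor X).obj x.rep) * (homDim K X X : ℝ)
        = homDim K (𝟙_ C) T.V * (regularCoeff K x * homDim K (𝟙_ C) (X ⊗ x.rep)) := by
    intro x
    have h2 := homDim_action_mul_of_isDirectSum_unit hC.finite_hom hT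
      (isEndModule_tensorAction (isEndModule_selfAction X) x.rep) h
    have h3 : (homDim K T ((selfTensor X).obj x.rep) * homDim K X X : ℝ)
        = homDim K (𝟙_ C) T.V * homDim K (𝟙_ C) (X ⊗ x.rep) := by
      exact_mod_cast h2
    rw [mul_assoc, h3]
    ring
  rw [weightedHom, Finset.sum_mul, Finset.sum_congr rfl fun x _ => h1 x, ← Finset.mul_sum,
    hC.sum_regularCoeff_mul_homDim_tensor, hC.objFPdim_unit, hC.objFPdim_of_isDirectSum_unit h]
  ring

/-- The weighted count of equivariant maps out of `N` is a fixed multiple of the Frobenius-Perron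
dimension of `N`. Both sides are additive and multiply by `FPdim(Z)` under `N ↦ N ⊗ Z`, and they
agree when `N` is a multiple of the unit object. Splitting the unit-isotypic part off all the
`N ⊗ Y*`, weighted by the regular element, removes a fixed proportion of the dimension and nothing
of the defect, so that the ratio of the defect to the dimension contracts to zero. -/
theorem weightedHom_eq [Simple X] {N : Action C (End X)} (hN : IsEndModule N) :
    weightedHom K X N
      = objFPdim X * homDim K (𝟙_ C) (𝟙_ C) / homDim K X X * objFPdim N.V := by
  have := hC.finite_hom
  have := hC.simple_unit
  set e : ℝ := (homDim K (𝟙_ C) (𝟙_ C) : ℝ) with he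
  have hepos : 0 < e := Nat.cast_pos.2 (homDim_pos_of_ne (f := 𝟙 (𝟙_ C)) (id_nonzero _))
  have hdpos : (0 : ℝ) < homDim K X X :=
    Nat.cast_pos.2 (homDim_pos_of_ne (f := 𝟙 X) (id_nonzero _))
  set c : ℝ := objFPdim X * e / homDim K X X with hc
  have hcnn : 0 ≤ c := div_nonneg (mul_nonneg (hC.objFPdim_nonneg X) hepos.le) hdpos.le
  let δ : Action C (End X) → ℝ := fun N => weightedHom K X N - c * objFPdim N.V
  have hδ : ∀ N, δ N = weightedHom K X N - c * objFPdim N.V := fun N => rfl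
  let F : ℝ := ∑ y : SimpleClass C, regularCoeff K y * objFPdim y.rep
  have hF : e⁻¹ ≤ F := by
    let o := SimpleClass.mk (𝟙_ C) hC.simple_unit
    obtain ⟨i⟩ := SimpleClass.nonempty_rep_iso hC.simple_unit
    have h1 : regularCoeff K o * objFPdim o.rep = e⁻¹ := by
      rw [regularCoeff, hC.objFPdim_congr i, hC.objFPdim_unit, homDim_congr i i]
      simp [he]
    rw [← h1]
    exact Finset.single_le_sum (f := fun y : SimpleClass C => regularCoeff K y * objFPdim y.rep)
      (fun y _ => mul_nonneg (hC.regularCoeff_pos y).le (hC.objFPdim_nonneg _))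
      (Finset.mem_univ o)
  have hFpos : 0 < F := (inv_pos.2 hepos).trans_le hF
  -- one step of the contraction
  have step : ∀ q : ℝ, 0 ≤ q →
      (∀ N : Action C (End X), IsEndModule N → |δ N| ≤ q * objFPdim N.V) →
      ∀ N : Action C (End X), IsEndModule N →
        |δ N| ≤ q * (1 - (e * F)⁻¹) * objFPdim N.V := by
    intro q hq hbound N hN
    have h1 : ∀ y : SimpleClass C, objFPdim y.rep * |δ N|
        ≤ q * (objFPdim N.V * objFPdim y.rep - (homDim K N.V y.rep : ℝ) / e) := by
      intro y
      let N' := tensorAction N (y.rep)ᘁ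
      have hN' : IsEndModule N' := isEndModule_tensorAction hN _
      obtain ⟨T, M, i, p, i', p', hb, ⟨ι, _, j, r, hT⟩, h0, h0', hM⟩ :=
        hC.semisimple.exists_isotypic hC.simple_unit N'.V
      obtain ⟨T', M', i₁, p₁, i₂, p₂, hb', rfl, rfl⟩ := exists_isBinarySum_action N' hb h0 h0'
      have hT' : IsEndModule T' := Action.isEndModule_of_retract hN' hb'.self₁
      have hM' : IsEndModule M' := Action.isEndModule_of_retract hN' hb'.self₂
      have hδT : δ T' = 0 := by
        rw [hδ, hc, sub_eq_zero, div_mul_eq_mul_div, eq_div_iff hdpos.ne',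
          hC.weightedHom_of_isDirectSum_unit hT' hT]
        ring
      have hdual : objFPdim N'.V = objFPdim N.V * objFPdim y.rep := by
        rw [← hC.objFPdim_dual y.rep]
        exact hC.objFPdim_tensor _ _
      have hδN : δ N' = objFPdim y.rep * δ N := by
        rw [hδ, hδ, hdual, hC.weightedHom_tensor, hC.objFPdim_dual]
        ring
      have hFP := hC.objFPdim_isBinarySum hb
      have hδM : δ M' = objFPdim y.rep * δ N := by
        rw [← hδN, hδ, hδ N', hC.weightedHom_isBinarySum hb', hFP]
        rw [hδ] at hδT
        linarith
      have hdimT : (homDim K N.V y.rep : ℝ) = objFPdim T'.V * e := by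
        rw [← hC.objFPdim_of_isDirectSum_unit hT]
        have h2 : homDim K (𝟙_ C) N'.V = homDim K (𝟙_ C) T'.V + homDim K (𝟙_ C) M'.V :=
          hb.homDim_right _
        have h3 : homDim K (𝟙_ C) M'.V = 0 := homDim_eq_zero hM
        have h4 : homDim K (𝟙_ C) N'.V = homDim K N.V y.rep := by
          have h5 : homDim K (𝟙_ C) N'.V = homDim K (𝟙_ C ⊗ y.rep) N.V :=
            (homDim_tensor_dual _ _ _).symm
          rw [h5, homDim_congr (λ_ y.rep) (Iso.refl _), hC.semisimple.homDim_comm]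
        rw [← h4, h2, h3, add_zero]
      have h6 := hbound M' hM'
      rw [hδM, abs_mul, abs_of_nonneg (hC.objFPdim_nonneg _)] at h6
      have h7 : objFPdim M'.V
          = objFPdim N.V * objFPdim y.rep - (homDim K N.V y.rep : ℝ) / e := by
        rw [hdimT, mul_div_cancel_right₀ _ hepos.ne', ← hdual, hFP]
        ring
      rwa [h7] at h6
    have h2 : F * |δ N| ≤ q * (objFPdim N.V * F - objFPdim N.V / e) := by
      calc F * |δ N|
          = ∑ y : SimpleClass C, regularCoeff K y * (objFPdim y.rep * |δ N|) := by
            simp only [F, Finset.sum_mul, mul_assoc]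
        _ ≤ ∑ y : SimpleClass C, regularCoeff K y *
              (q * (objFPdim N.V * objFPdim y.rep - (homDim K N.V y.rep : ℝ) / e)) :=
            Finset.sum_le_sum fun y _ =>
              mul_le_mul_of_nonneg_left (h1 y) (hC.regularCoeff_pos y).le
        _ = q * (objFPdim N.V * F
              - (∑ y : SimpleClass C, regularCoeff K y * homDim K N.V y.rep) / e) := by
            simp only [F, Finset.mul_sum, Finset.sum_div, ← Finset.sum_sub_distrib]
            exact Finset.sum_congr rfl fun y _ => by ring
        _ = _ := by rw [hC.sum_regularCoeff_mul_homDim]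
    have h3 : q * (objFPdim N.V * F - objFPdim N.V / e)
        = F * (q * (1 - (e * F)⁻¹) * objFPdim N.V) := by
      field_simp
    rw [h3] at h2
    exact le_of_mul_le_mul_left h2 hFpos
  let q₀ : ℝ := objFPdim X + c
  have hq₀ : 0 ≤ q₀ := add_nonneg (hC.objFPdim_nonneg X) hcnn
  let κ : ℝ := 1 - (e * F)⁻¹
  have hκ0 : 0 ≤ κ := by
    have h1 : 1 ≤ e * F := by
      have := mul_le_mul_of_nonneg_left hF hepos.le
      rwa [mul_inv_cancel₀ hepos.ne'] at this
    exact sub_nonneg.2 (inv_le_one_of_one_le₀ h1)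
  have hκ1 : κ < 1 := sub_lt_self _ (inv_pos.2 (mul_pos hepos hFpos))
  have hall : ∀ (n : ℕ) (N : Action C (End X)), IsEndModule N →
      |δ N| ≤ q₀ * κ ^ n * objFPdim N.V := by
    intro n
    induction n with
    | zero =>
      intro N _
      have h1 := hC.weightedHom_nonneg N
      have h2 := hC.weightedHom_le N
      have h3 := mul_nonneg hcnn (hC.objFPdim_nonneg N.V)
      have h4 := mul_nonneg (hC.objFPdim_nonneg X) (hC.objFPdim_nonneg N.V)
      rw [hδ, pow_zero, mul_one, abs_le]
      constructor <;> simp only [q₀] <;> linarith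
    | succ n ih =>
      intro N hN
      have := step (q₀ * κ ^ n) (mul_nonneg hq₀ (pow_nonneg hκ0 n)) ih N hN
      rwa [pow_succ, ← mul_assoc]
  have hlim : Filter.Tendsto (fun n : ℕ => q₀ * κ ^ n * objFPdim N.V) Filter.atTop (nhds 0) := by
    have := ((tendsto_pow_atTop_nhds_zero_of_lt_one hκ0 hκ1).const_mul q₀).mul_const (objFPdim N.V)
    simpa using this
  have h0 : |δ N| ≤ 0 := ge_of_tendsto' hlim fun n => hall n N hN
  exact sub_eq_zero.1 (abs_nonpos_iff.1 h0)

/-- The Frobenius-Perron dimension of `X* ⊗_{End(X)} X` for simple `X`. -/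
theorem weightedHom_self [Simple X] :
    weightedHom K X (selfAction X) = objFPdim X ^ 2 / dimEnd X := by
  have := hC.simple_unit
  have := hC.finite_hom
  have he : (0 : ℝ) < homDim K (𝟙_ C) (𝟙_ C) :=
    Nat.cast_pos.2 (homDim_pos_of_ne (f := 𝟙 (𝟙_ C)) (id_nonzero _))
  rw [hC.weightedHom_eq (isEndModule_selfAction X), ← homDim_unit_mul_dimEnd K X, Nat.cast_mul,
    mul_comm (objFPdim X), mul_div_mul_left _ _ he.ne', selfAction_V]
  ring

end IsFusionCategory

/-! ### The quotient of `X* ⊗ X` by the action of `End(X)` -/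

section EndTensor

variable {K : Type w} {C : Type u} [Field K] [Category.{v} C] [Abelian C] [Linear K C]
  [MonoidalCategory C] [MonoidalPreadditive C] [MonoidalLinear K C] [RigidCategory C]

variable (K) in
/-- Passing to the dual morphism, as a linear map. -/
def mateLinearMap (X Y : C) : (X ⟶ Y) →ₗ[K] (Yᘁ ⟶ Xᘁ) where
  toFun f := fᘁ
  map_add' f g := by simp [rightAdjointMate]
  map_smul' c f := by simp [rightAdjointMate]

theorem exists_isEndTensor (X : C) [Module.Finite K (X ⟶ X)] :
    ∃ (Q : C) (π : Xᘁ ⊗ X ⟶ Q), IsEndTensor X π := by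
  let b := Module.finBasis K (X ⟶ X)
  let D : (X ⟶ X) →ₗ[K] (Xᘁ ⊗ X ⟶ Xᘁ ⊗ X) :=
    { toFun := fun f => mateLinearMap K X X f ▷ X - Xᘁ ◁ f
      map_add' := fun f g => by
        rw [map_add, MonoidalPreadditive.add_whiskerRight, MonoidalPreadditive.whiskerLeft_add]
        abel
      map_smul' := fun c f => by
        rw [map_smul, MonoidalLinear.smul_whiskerRight, MonoidalLinear.whiskerLeft_smul,
          RingHom.id_apply, smul_sub] }
  have hD : ∀ {Z : C} (g : Xᘁ ⊗ X ⟶ Z) (f : X ⟶ X),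
      fᘁ ▷ X ≫ g = Xᘁ ◁ f ≫ g ↔ D f ≫ g = 0 := by
    intro Z g f
    rw [← sub_eq_zero, ← Preadditive.sub_comp]
    rfl
  let R := biproduct.desc fun i => D (b i)
  refine ⟨cokernel R, cokernel.π R, fun f => (hD _ f).2 ?_, fun Z g hg => ?_⟩
  · -- the relation is linear in `f`, so that a basis of `End(X)` suffices
    have h : (Linear.rightComp K ((Xᘁ : C) ⊗ X) (cokernel.π R)) ∘ₗ D = 0 := by
      refine b.ext fun i => ?_
      change D (b i) ≫ cokernel.π R = 0
      have : D (b i) = biproduct.ι (fun _ => (Xᘁ : C) ⊗ X) i ≫ R := by simp [R]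
      rw [this, Category.assoc, cokernel.condition, comp_zero]
    exact LinearMap.congr_fun h f
  · have h : R ≫ g = 0 := by
      ext i
      simp only [R, biproduct.ι_desc_assoc, comp_zero]
      exact (hD g (b i)).1 (hg _)
    exact ⟨cokernel.desc R g h, cokernel.π_desc _ _ _, fun k hk => by
      rw [← cancel_epi (cokernel.π R), hk, cokernel.π_desc]⟩

omit [Abelian C] [MonoidalPreadditive C] in
theorem tensorLeftHomEquiv_mate_comp {X W : C} (f : X ⟶ X) (g : Xᘁ ⊗ X ⟶ W) :
    tensorLeftHomEquiv X X Xᘁ W (fᘁ ▷ X ≫ g) = tensorLeftHomEquiv X X Xᘁ W g ≫ f ▷ W := by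
  have h := coevaluation_comp_rightAdjointMate f
  have h1 : η_ X Xᘁ ▷ X ≫ (X ◁ fᘁ) ▷ X = η_ X Xᘁ ▷ X ≫ (f ▷ Xᘁ) ▷ X := by
    rw [← comp_whiskerRight, h, comp_whiskerRight]
  simp only [tensorLeftHomEquiv, Equiv.coe_fn_mk, MonoidalCategory.whiskerLeft_comp,
    Category.assoc]
  congr 1
  rw [← associator_naturality_middle_assoc, reassoc_of% h1, associator_naturality_left_assoc,
    ← whisker_exchange]

omit [Abelian C] [MonoidalPreadditive C] in
theorem tensorLeftHomEquiv_whiskerLeft_comp {X W : C} (f : X ⟶ X) (g : Xᘁ ⊗ X ⟶ W) :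
    tensorLeftHomEquiv X X Xᘁ W (Xᘁ ◁ f ≫ g) = f ≫ tensorLeftHomEquiv X X Xᘁ W g := by
  apply (tensorLeftHomEquiv X X Xᘁ W).symm.injective
  rw [tensorLeftHomEquiv_symm_naturality, Equiv.symm_apply_apply, Equiv.symm_apply_apply]

/-- Maps out of `X* ⊗_{End(X)} X` are the `End(X)`-equivariant maps `X ⟶ X ⊗ W`. -/
theorem IsEndTensor.homDim_eq {X Q : C} {π : Xᘁ ⊗ X ⟶ Q} (h : IsEndTensor X π) (W : C) :
    homDim K Q W = homDim K (selfAction X) ((selfTensor X).obj W) := by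
  let E := dualTensorLinearEquiv K X X W
  have hE : ∀ g, E g = tensorLeftHomEquiv X X Xᘁ W g := fun _ => rfl
  let Φ : (Q ⟶ W) →ₗ[K] (selfAction X ⟶ (selfTensor X).obj W) :=
    { toFun := fun k =>
        { hom := E (π ≫ k)
          comm := fun f => by
            change f ≫ E (π ≫ k) = E (π ≫ k) ≫ End.asHom f ▷ W
            have h1 := congrArg (fun t => tensorLeftHomEquiv X X Xᘁ W (t ≫ k)) (h.balanced f)
            simp only [Category.assoc] at h1
            rw [tensorLeftHomEquiv_mate_comp, tensorLeftHomEquiv_whiskerLeft_comp] at h1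
            exact h1.symm }
      map_add' := fun k k' => Action.Hom.ext (by
        change E (π ≫ (k + k')) = E (π ≫ k) + E (π ≫ k')
        rw [Preadditive.comp_add, map_add])
      map_smul' := fun c k => Action.Hom.ext (by
        change E (π ≫ (c • k)) = c • E (π ≫ k)
        rw [Linear.comp_smul, map_smul]) }
  refine (LinearEquiv.ofBijective Φ ⟨fun k k' hk => ?_, fun t => ?_⟩).finrank_eq
  · have h1 : E (π ≫ k) = E (π ≫ k') := congrArg Action.Hom.hom hk
    exact (h.universal W (π ≫ k) fun f => by
      rw [← Category.assoc, h.balanced, Category.assoc]).unique rfl (E.injective h1).symm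
  · let t' : X ⟶ X ⊗ W := t.hom
    obtain ⟨k, hk, -⟩ := h.universal W (E.symm t') fun f => by
      apply (tensorLeftHomEquiv X X Xᘁ W).injective
      rw [tensorLeftHomEquiv_mate_comp, tensorLeftHomEquiv_whiskerLeft_comp, ← hE,
        E.apply_symm_apply]
      exact (t.comm f).symm
    refine ⟨k, Action.Hom.ext ?_⟩
    change E (π ≫ k) = t'
    rw [hk, E.apply_symm_apply]

theorem IsFusionCategory.objFPdim_endTensor (hC : IsFusionCategory K C) {X Q : C} [Simple X]
    {π : Xᘁ ⊗ X ⟶ Q} (h : IsEndTensor X π) : objFPdim Q = objFPdim X ^ 2 / dimEnd X := by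
  have := hC.finite_simpleClass
  let _ := Fintype.ofFinite (SimpleClass C)
  rw [← hC.weightedHom_self, ← hC.sum_regularCoeff_mul_homDim]
  exact Finset.sum_congr rfl fun x _ => by rw [h.homDim_eq]

end EndTensor

/-! ### The coend -/

section Coend

variable {K : Type w} {C : Type u} [Field K] [Category.{v} C] [Abelian C] [Linear K C]
  [MonoidalCategory C] [MonoidalPreadditive C] [MonoidalLinear K C] [RigidCategory C]

omit [RigidCategory C] in
theorem whiskerLeft_retracts_comp {V W Z : C} {ι : Type*} [Fintype ι] {X : ι → C}
    {j : ∀ a, X a ⟶ V} {p : ∀ a, V ⟶ X a} (h : IsDirectSum X j p) (g : W ⊗ V ⟶ Z) :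
    g = ∑ a, W ◁ p a ≫ W ◁ j a ≫ g := by
  simp only [← Category.assoc, ← MonoidalCategory.whiskerLeft_comp]
  rw [← Preadditive.sum_comp]
  have : ∑ a, W ◁ (p a ≫ j a) = 𝟙 (W ⊗ V) := by
    rw [← MonoidalCategory.whiskerLeft_id, ← h.total]
    exact (map_sum ((tensorLeft W).mapAddHom) _ _).symm
  rw [this, Category.id_comp]

omit [MonoidalLinear K C] in
/-- A dinatural family `V* ⊗ V ⟶ Z` is determined by its members at the simple objects. -/
theorem IsSemisimpleCategory.dinatural_ext (hS : IsSemisimpleCategory K C) {Z : C}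
    {h h' : ∀ V : C, Vᘁ ⊗ V ⟶ Z} (hh : ∀ {V W : C} (f : V ⟶ W), fᘁ ▷ V ≫ h V = Wᘁ ◁ f ≫ h W)
    (hh' : ∀ {V W : C} (f : V ⟶ W), fᘁ ▷ V ≫ h' V = Wᘁ ◁ f ≫ h' W)
    (hx : ∀ x : SimpleClass C, h x.rep = h' x.rep) (V : C) : h V = h' V := by
  obtain ⟨n, x, j, p, hV⟩ := hS.exists_isDirectSum_rep V
  rw [whiskerLeft_retracts_comp hV (h V), whiskerLeft_retracts_comp hV (h' V)]
  exact Finset.sum_congr rfl fun a _ => by rw [← hh, ← hh', hx]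

/-- A family of balanced maps `X* ⊗ X ⟶ Z`, one for each simple object, extends to a dinatural
family on all objects. -/
theorem IsSemisimpleCategory.exists_dinatural (hS : IsSemisimpleCategory K C) {Z : C}
    (t : ∀ x : SimpleClass C, x.repᘁ ⊗ x.rep ⟶ Z)
    (ht : ∀ (x : SimpleClass C) (f : x.rep ⟶ x.rep), fᘁ ▷ x.rep ≫ t x = x.repᘁ ◁ f ≫ t x) :
    ∃ h : ∀ V : C, Vᘁ ⊗ V ⟶ Z, (∀ {V W : C} (f : V ⟶ W), fᘁ ▷ V ≫ h V = Wᘁ ◁ f ≫ h W) ∧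
      ∀ x : SimpleClass C, h x.rep = t x := by
  -- dinaturality between simple objects: there are no non-zero maps between different classes
  have key : ∀ {x y : SimpleClass C} (g : x.rep ⟶ y.rep),
      gᘁ ▷ x.rep ≫ t x = y.repᘁ ◁ g ≫ t y := by
    intro x y g
    by_cases hxy : x = y
    · subst hxy
      exact ht x g
    · have h0 : (0 : x.rep ⟶ y.rep)ᘁ = 0 := (mateLinearMap K x.rep y.rep).map_zero
      rw [SimpleClass.hom_eq_zero hxy g, h0]
      simp
  choose n x j p hV using hS.exists_isDirectSum_rep
  refine ⟨fun V => ∑ a, (j V a)ᘁ ▷ V ≫ (x V a).repᘁ ◁ p V a ≫ t (x V a), ?_, ?_⟩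
  · intro V W f
    have hj : ∀ a, (j V a ≫ f)ᘁ = ∑ b, (j W b)ᘁ ≫ (j V a ≫ f ≫ p W b)ᘁ := by
      intro a
      have h1 : j V a ≫ f = ∑ b, (j V a ≫ f ≫ p W b) ≫ j W b := by
        simp only [Category.assoc]
        rw [← Preadditive.comp_sum, ← Preadditive.comp_sum, (hV W).total, Category.comp_id]
      refine (congrArg (mateLinearMap K _ _) h1).trans ?_
      rw [map_sum]
      exact Finset.sum_congr rfl fun b _ => comp_rightAdjointMate
    calc fᘁ ▷ V ≫ ∑ a, (j V a)ᘁ ▷ V ≫ (x V a).repᘁ ◁ p V a ≫ t (x V a)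
        = ∑ a, (j V a ≫ f)ᘁ ▷ V ≫ (x V a).repᘁ ◁ p V a ≫ t (x V a) := by
          rw [Preadditive.comp_sum]
          refine Finset.sum_congr rfl fun a _ => ?_
          rw [comp_rightAdjointMate, comp_whiskerRight, Category.assoc]
      _ = ∑ a, ∑ b, (j W b)ᘁ ▷ V ≫ ((x W b).repᘁ : C) ◁ p V a ≫
            ((x W b).repᘁ : C) ◁ (j V a ≫ f ≫ p W b) ≫ t (x W b) := by
          refine Finset.sum_congr rfl fun a _ => ?_
          have h2 : (∑ b, (j W b)ᘁ ≫ (j V a ≫ f ≫ p W b)ᘁ) ▷ V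
              = ∑ b, ((j W b)ᘁ ≫ (j V a ≫ f ≫ p W b)ᘁ) ▷ V :=
            map_sum ((tensorRight V).mapAddHom) _ _
          rw [hj, h2, Preadditive.sum_comp]
          refine Finset.sum_congr rfl fun b _ => ?_
          rw [← key, comp_whiskerRight, Category.assoc, whisker_exchange_assoc]
      _ = ∑ b, (j W b)ᘁ ▷ V ≫ (x W b).repᘁ ◁ (f ≫ p W b) ≫ t (x W b) := by
          rw [Finset.sum_comm]
          refine Finset.sum_congr rfl fun b _ => ?_
          rw [← Preadditive.comp_sum]
          conv_rhs => rw [whiskerLeft_retracts_comp (hV V) (((x W b).repᘁ : C) ◁ (f ≫ p W b) ≫ t (x W b))]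
          simp only [MonoidalCategory.whiskerLeft_comp, Category.assoc]
      _ = Wᘁ ◁ f ≫ ∑ b, (j W b)ᘁ ▷ W ≫ (x W b).repᘁ ◁ p W b ≫ t (x W b) := by
          rw [Preadditive.comp_sum]
          refine Finset.sum_congr rfl fun b _ => ?_
          rw [whisker_exchange_assoc, MonoidalCategory.whiskerLeft_comp, Category.assoc]
  · intro y
    rw [whiskerLeft_retracts_comp (hV y.rep) (t y)]
    refine Finset.sum_congr rfl fun a _ => ?_
    rw [← whisker_exchange_assoc, key]

/-- The direct sum of the objects `X* ⊗_{End(X)} X` over the simple classes is the canonical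
coend. -/
theorem IsSemisimpleCategory.hasCoend_dualTensor (hS : IsSemisimpleCategory K C)
    [Finite (SimpleClass C)] {Q : SimpleClass C → C}
    {π : ∀ x : SimpleClass C, x.repᘁ ⊗ x.rep ⟶ Q x} (hπ : ∀ x, IsEndTensor x.rep (π x)) :
    ∃ (_ : HasCoend (dualTensor C)) (i : coend (dualTensor C) ≅ ⨁ Q),
      ∀ x : SimpleClass C,
        coend.ι (dualTensor C) x.rep ≫ i.hom = π x ≫ biproduct.ι Q x := by
  obtain ⟨h, hh, hx⟩ := hS.exists_dinatural (fun x => π x ≫ biproduct.ι Q x) fun x f => by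
    rw [← Category.assoc, (hπ x).balanced, Category.assoc]
  let c : Cowedge (dualTensor C) := Cowedge.mk (⨁ Q) h fun _ _ f => hh f
  have hdin : ∀ (s : Cowedge (dualTensor C)) {V W : C} (f : V ⟶ W),
      fᘁ ▷ V ≫ s.π V = Wᘁ ◁ f ≫ s.π W := fun s _ _ f => Cowedge.condition s f
  choose d hd hd' using fun (s : Cowedge (dualTensor C)) (x : SimpleClass C) =>
    (hπ x).universal s.pt (s.π x.rep) fun f => hdin s f
  have huniq : ∀ (s : Cowedge (dualTensor C)) (m : (⨁ Q) ⟶ s.pt),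
      (∀ x : SimpleClass C, h x.rep ≫ m = s.π x.rep) → m = biproduct.desc (d s) := by
    intro s m hm
    ext x
    rw [biproduct.ι_desc]
    refine hd' s x _ ?_
    change π x ≫ biproduct.ι Q x ≫ m = _
    rw [← hm, hx, Category.assoc]
  let hc : IsColimit c := Multicofork.IsColimit.mk c (fun s => biproduct.desc (d s))
    (fun s V => by
      refine hS.dinatural_ext (h := fun V => h V ≫ biproduct.desc (d s)) (h' := fun V => s.π V)
        (fun f => ?_) (hdin s) (fun x => ?_) V
      · rw [← Category.assoc, hh, Category.assoc]
      · change h x.rep ≫ _ = _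
        rw [hx, Category.assoc, biproduct.ι_desc]
        exact hd s x)
    (fun s m hm => huniq s m fun x => hm x.rep)
  have hco : HasCoend (dualTensor C) := HasColimit.mk ⟨c, hc⟩
  refine ⟨hco, (colimit.isColimit _).coconePointUniqueUpToIso hc, fun x => ?_⟩
  rw [← hx]
  exact IsColimit.comp_coconePointUniqueUpToIso_hom (colimit.isColimit _) hc
    (WalkingMultispan.right x.rep)

end Coend

/-! ### The dimension of the coend -/

namespace IsFusionCategory

variable {K : Type w} {C : Type u} [Field K] [Category.{v} C] [Abelian C] [Linear K C]
  [MonoidalCategory C] [MonoidalPreadditive C] [MonoidalLinear K C] [RigidCategory C]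
  (hC : IsFusionCategory K C)
include hC

theorem dimEnd_pos (x : SimpleClass C) : 0 < dimEnd x.rep := by
  have := hC.simple_unit
  have h := hC.semisimple.homDim_self_pos x
  rw [← homDim_unit_mul_dimEnd K x.rep] at h
  exact Nat.pos_of_mul_pos_left h

theorem catFPdim_eq [Fintype (SimpleClass C)] :
    catFPdim C = ∑ x : SimpleClass C, objFPdim x.rep ^ 2 / (dimEnd x.rep : ℝ) := by
  classical
  have h1 : ∀ x : SimpleClass C, regularElement C x = objFPdim x.rep / dimEnd x.rep := by
    intro x
    rw [regularElement, finsum_eq_sum_of_fintype, Finsupp.finsetSum_apply,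
      Finset.sum_eq_single x (fun y _ hy => Finsupp.single_eq_of_ne hy.symm) (by simp),
      Finsupp.single_eq_same]
  rw [catFPdim, hC.elemFPdim_eq fun x => by
    rw [h1]; exact div_nonneg (hC.objFPdim_nonneg _) (Nat.cast_nonneg _), hC.character_eq_sum]
  exact Finset.sum_congr rfl fun x _ => by rw [h1]; ring

/-- Multiplication by `FPdim(V)` preserves the lattice spanned by the dimensions of the simple
objects. -/
theorem isIntegral_objFPdim (V : C) : IsIntegral ℤ (objFPdim V) := by
  have := hC.finite_simpleClass
  let _ := Fintype.ofFinite (SimpleClass C)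
  let N : Submodule ℤ ℝ := Submodule.span ℤ (Set.range fun x : SimpleClass C => objFPdim x.rep)
  have hmem : ∀ x : SimpleClass C, objFPdim x.rep ∈ N := fun x =>
    Submodule.subset_span ⟨x, rfl⟩
  refine isIntegral_of_smul_mem_submodule (N := N) ?_
    (Submodule.fg_span (Set.finite_range _)) _ fun r hr => ?_
  · obtain ⟨x⟩ := hC.nonempty_simpleClass
    exact fun h => (hC.objFPdim_rep_pos x).ne' ((Submodule.mem_bot ℤ).1 (h ▸ hmem x))
  · induction hr using Submodule.span_induction with
    | mem r hr =>
      obtain ⟨x, rfl⟩ := hr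
      change objFPdim V * objFPdim x.rep ∈ N
      rw [← hC.objFPdim_tensor, hC.objFPdim_eq, hC.character_eq_sum]
      refine N.sum_mem fun y _ => ?_
      have : realClass (V ⊗ x.rep) y * objFPdim y.rep
          = (objClass (V ⊗ x.rep) y : ℤ) • objFPdim y.rep := by
        rw [zsmul_eq_mul]
        rfl
      rw [this]
      exact N.smul_mem _ (hmem y)
    | zero => rw [smul_zero]; exact N.zero_mem
    | add r s _ _ hr hs => rw [smul_add]; exact N.add_mem hr hs
    | smul c r _ hr => rw [smul_comm]; exact N.smul_mem c hr

end IsFusionCategory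

end NACFusion

theorem mainTheorem2 (K : Type w) [Field K] (C : Type u) [Category.{v} C] [Abelian C] [Linear K C]
    [MonoidalCategory C] [MonoidalPreadditive C] [MonoidalLinear K C] [RigidCategory C]
    (hC : NACFusion.IsFusionCategory K C) :
    -- the quantities below are well defined
    (∀ V : C, ∃! m, NACFusion.IsClassOf V m) ∧
    (∀ a : NACFusion.SimpleClass C →₀ ℝ, (∀ x, 0 ≤ a x) →
      IsGreatest (NACFusion.nonnegEigenvalues a) (NACFusion.elemFPdim a)) ∧
    (∀ x : NACFusion.SimpleClass C, 0 < NACFusion.dimEnd x.rep) ∧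
    ∃ (_ : Finite (NACFusion.SimpleClass C)) (_ : HasCoend (NACFusion.dualTensor C)),
      -- the canonical coend is the direct sum of the objects `X* ⊗_{End(X)} X`
      (∃ (Q : NACFusion.SimpleClass C → C) (π : ∀ x : NACFusion.SimpleClass C, x.repᘁ ⊗ x.rep ⟶ Q x)
          (i : coend (NACFusion.dualTensor C) ≅ ⨁ Q),
        (∀ x, NACFusion.IsEndTensor x.rep (π x)) ∧
        ∀ x, coend.ι (NACFusion.dualTensor C) x.rep ≫ i.hom = π x ≫ biproduct.ι Q x) ∧
      -- its dimension is the dimension of the category, which is an algebraic integer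
      NACFusion.objFPdim (coend (NACFusion.dualTensor C)) = NACFusion.catFPdim C ∧
      NACFusion.catFPdim C =
        ∑ᶠ x : NACFusion.SimpleClass C,
          NACFusion.objFPdim x.rep ^ 2 / (NACFusion.dimEnd x.rep : ℝ) ∧
      IsIntegral ℤ (NACFusion.catFPdim C) := by
  have hfin := hC.finite_simpleClass
  let _ := Fintype.ofFinite (NACFusion.SimpleClass C)
  have := hC.finite_hom
  choose Q π hπ using fun x : NACFusion.SimpleClass C =>
    NACFusion.exists_isEndTensor (K := K) x.rep
  obtain ⟨hco, i, hi⟩ := hC.semisimple.hasCoend_dualTensor hπ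
  have hdim : NACFusion.objFPdim (coend (NACFusion.dualTensor C)) = NACFusion.catFPdim C := by
    rw [hC.objFPdim_isDirectSum (NACFusion.IsDirectSum.of_iso i), hC.catFPdim_eq]
    exact Finset.sum_congr rfl fun x _ => hC.objFPdim_endTensor (hπ x)
  refine ⟨fun V => ?_, fun a ha => ?_, hC.dimEnd_pos, hfin, hco, ⟨Q, π, i, hπ, hi⟩, hdim, ?_, ?_⟩
  · obtain ⟨m, hm⟩ := hC.semisimple.exists_isClassOf V
    exact ⟨m, hm, fun m' hm' => hC.semisimple.isClassOf_unique hm' hm⟩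
  · rw [hC.elemFPdim_eq ha]
    exact hC.isGreatest_character ha
  · rw [hC.catFPdim_eq, finsum_eq_sum_of_fintype]
  · rw [← hdim]
    exact hC.isIntegral_objFPdim _
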